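/- Let $\theta>1$. Let $\mathrm{H}_k$ ($k=0,1,2,\dots$) be the Hermite polynomials in the standard normalization, $\mathrm{H}_0=1$, $\mathrm{H}_{k+1}(x)=2x\,\mathrm{H}_k(x)-\mathrm{H}_k'(x)$, and let $\mathbb{H}_k=(2^k k!\sqrt{\pi})^{-1/2}\,\mathrm{H}_k$ be the orthonormal ones for the weight $e^{-x^2}$ on $\mathbf{R}$. For $f:\mathbf{R}\to\mathbb{C}$ in $L^2(\mathbf{R},e^{-x^2}dx)$ put $$f_k=\int_{-\infty}^{\infty} f(x)\,\mathbb{H}_k(x)\,e^{-x^2}\,dx,$$ and let $\mathcal{H}_\theta$ be the set of all such $f$ with $\sum_{k=0}^\infty |f_k|^2\theta^k<\infty$. Write $$w_\theta(z)=\exp\left[-2\left(\frac{(\Re z)^2}{\theta+1}+\frac{(\Im z)^2}{\theta-1}\right)\right],\qquad z\in\mathbb{C},$$ and let $d\sigma$ be Lebesgue area measure on $\mathbb{C}$. An entire function $F$ is said to extend $f$ if $f(x)=F(x)$ for almost every $x\in\mathbf{R}$. (i) A function $f:\mathbf{R}\to\mathbb{C}$ belongs to $\mathcal{H}_\theta$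 if and only if it is extended by an entire function $F$ with $\int_{\mathbb{C}}|F(z)|^2 w_\theta(z)\,d\sigma<\infty$. (ii) If $f\in\mathcal{H}_\theta$ is extended by the entire function $F$, then $\int_{\mathbb{C}}|F|^2 w_\theta\,d\sigma<\infty$ and $$\sum_{k=0}^\infty |f_k|^2\theta^k=\frac{2}{\sqrt{\pi(\theta^2-1)}}\int_{\mathbb{C}}|F(z)|^2\,w_\theta(z)\,d\sigma.$$ (iii) If $f,g\in\mathcal{H}_\theta$ are extended by the entire functions $F,G$, then $F\overline{G}\,w_\theta$ is integrable over $\mathbb{C}$ and $$\sum_{k=0}^\infty f_k\,\overline{g_k}\,\theta^k=\frac{2}{\sqrt{\pi(\theta^2-1)}}\int_{\mathbb{C}}F(z)\,\overline{G(z)}\,w_\theta(z)\,d\sigma,$$ the series converging absolutely. (iv) For all integers $k,m\ge 0$ the following integral converges absolutely and $$\frac{2}{\sqrt{\theta^2-1}}\int_{\mathbb{C}}\mathrm{H}_k(z)\,\overline{\mathrm{H}_m(z)}\,w_\theta(z)\,d\sigma=\delta_{k,m}\,\pi\,(2\theta)^k\,k!.$$ -/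

import Mathlib

open MeasureTheory Polynomial

noncomputable section

namespace HermiteExpansion

/-- The standardly normalized (physicists') Hermite polynomials, `H₀ = 1`,
`Hₙ₊₁ = 2 X Hₙ - Hₙ'`, that is `Hₙ(x) = (-1)ⁿ exp(x²) (d/dx)ⁿ exp(-x²)`. -/
def hermiteH : ℕ → ℤ[X]
  | 0 => 1
  | n + 1 => 2 * X * hermiteH n - derivative (hermiteH n)

/-- The orthonormal Hermite polynomials on `ℝ` for the weight `exp(-x²)`:
`Hₖ(x) / √(2ᵏ k! √π)`. -/
def hermiteON (k : ℕ) (x : ℝ) : ℝ :=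
  aeval x (hermiteH k) / √(2 ^ k * (k.factorial : ℝ) * √Real.pi)

/-- The measure `exp(-x²) dx` on `ℝ`. -/
def hermiteMeasure : Measure ℝ :=
  volume.withDensity fun x => ENNReal.ofReal (Real.exp (-x ^ 2))

/-- The Fourier–Hermite coefficient `f_k = ∫ f(x) h_k(x) exp(-x²) dx`. -/
def hermiteCoeff (f : ℝ → ℂ) (k : ℕ) : ℂ :=
  ∫ x : ℝ, f x * (hermiteON k x : ℂ) * (Real.exp (-x ^ 2) : ℂ)

/-- `f ∈ L²(exp(-x²) dx)` and `∑ₖ |f_k|² θᵏ < ∞`. -/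
def MemHermiteSpace (θ : ℝ) (f : ℝ → ℂ) : Prop :=
  MemLp f 2 hermiteMeasure ∧ Summable fun k : ℕ => ‖hermiteCoeff f k‖ ^ 2 * θ ^ k

/-- `F` is entire and `f` is, up to a Lebesgue null set, its restriction to `ℝ`. -/
def IsEntireExtension (f : ℝ → ℂ) (F : ℂ → ℂ) : Prop :=
  Differentiable ℂ F ∧ ∀ᵐ x : ℝ, f x = F (x : ℂ)

/-- The weight `exp[-2((Re z)²/(θ+1) + (Im z)²/(θ-1))]`. -/
def areaWeight (θ : ℝ) (z : ℂ) : ℝ :=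
  Real.exp (-2 * (z.re ^ 2 / (θ + 1) + z.im ^ 2 / (θ - 1)))

end HermiteExpansion

end

/-!
# Hermite expansions and the weighted Bergman space

Three facts combine.

The heart is a formula relating the area measure to the real line: for an entire function `F` of
moderate growth, `∫ F(z) conj (H_k(z)) w_θ(z) dσ` equals `√(π (θ² - 1)) / 2 * θ ^ k` times
`∫ F(x) H_k(x) exp(-x²) dx` (`integral_mul_conj_hermiteC`). On the horizontal line of height `y` the
antiholomorphic variable `x - i y` is the holomorphic function `z - 2 i y` of `z = x + i y`, so the
line can be moved to the real axis without touching `F`. The remaining `y`-integral is a Gaussian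
average of `H_k`, and such an average returns a constant times `θ ^ k H_k(x) exp(-x²)`
(`gaussianFunctional_hermiteC_comp`). With `F = H_m`, orthogonality on the real line becomes
orthogonality over the plane.

The sub-mean value property on unit discs bounds point evaluations on the weighted Bergman space
(`sq_norm_le_of_integrable`). Hence every function in that space has moderate growth and a square
integrable restriction to the real line, and by the formula its inner products with the normalized
`H_k` are `θ ^ (k / 2)` times the Hermite coefficients of the restriction. Bessel's inequality then
puts the restriction into the Hermite space (`memHermiteSpace_of_integrable`).

Conversely, for `f` in the Hermite space the series `∑ f_k h_k(z)` in the orthonormal Hermite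
polynomials `h_k` (`hermiteONC`) converges locally uniformly, by the point
evaluation bounds in the Bergman space of a parameter between `1` and `θ`
(`exists_entire_hasSum`). It converges in the Bergman space by orthonormality, and on the real line
it converges to `f` by completeness of the Hermite polynomials (`hasSum_hermiteCoeff_smul`). So its
sum is the only entire extension of `f`, and Parseval's identity gives the norm and inner product
formulas (`hasSum_hermiteCoeff_mul_conj`).
-/

noncomputable section

namespace HermiteExpansion

/-! ### Contour shifts and the mean value property over discs -/

/-- The integral of an entire function along a horizontal line does not depend on the line, provided
the function has Gaussian decay between the two lines. -/
theorem integral_add_mul_I_eq_integral {K : ℂ → ℂ} (hK : Differentiable ℂ K) {c C y : ℝ}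
    (hc : 0 < c)
    (hb : ∀ x t : ℝ, |t| ≤ |y| → ‖K (x + t * Complex.I)‖ ≤ C * Real.exp (-c * x ^ 2)) :
    ∫ x : ℝ, K (x + y * Complex.I) = ∫ x : ℝ, K x := by
  have hint : ∀ t : ℝ, |t| ≤ |y| → Integrable fun x : ℝ => K (x + t * Complex.I) := by
    intro t ht
    refine ((integrable_exp_neg_mul_sq hc).const_mul C).mono' ?_ (.of_forall fun x => hb x t ht)
    exact (hK.continuous.comp (by fun_prop)).aestronglyMeasurable
  have h0 : Integrable fun x : ℝ => K x := by simpa using hint 0 (by simp)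
  have hbot := intervalIntegral_tendsto_integral h0 Filter.tendsto_neg_atTop_atBot Filter.tendsto_id
  have htop := intervalIntegral_tendsto_integral (hint y le_rfl) Filter.tendsto_neg_atTop_atBot
    Filter.tendsto_id
  have hexp : Filter.Tendsto (fun T : ℝ => C * Real.exp (-c * T ^ 2) * |y|) Filter.atTop
      (nhds 0) := by
    have h1 : Filter.Tendsto (fun T : ℝ => -c * T ^ 2) Filter.atTop Filter.atBot :=
      Filter.Tendsto.const_mul_atTop_of_neg (by linarith) (Filter.tendsto_pow_atTop two_ne_zero)
    simpa using ((Real.tendsto_exp_atBot.comp h1).const_mul C).mul_const |y|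
  have hside : ∀ s : ℝ, s ^ 2 = 1 → Filter.Tendsto
      (fun T : ℝ => ∫ t in (0 : ℝ)..y, K (((s * T : ℝ) : ℂ) + t * Complex.I)) Filter.atTop
      (nhds 0) := by
    intro s hs
    refine squeeze_zero_norm (fun T => ?_) hexp
    refine (intervalIntegral.norm_integral_le_of_norm_le_const fun t ht => ?_).trans
      (by rw [sub_zero])
    have := hb (s * T) t ?_
    · rwa [mul_pow, hs, one_mul] at this
    · rcases le_total 0 y with h | h
      · rw [Set.uIoc_of_le h] at ht
        rw [abs_of_nonneg ht.1.le, abs_of_nonneg h]; exact ht.2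
      · rw [Set.uIoc_of_ge h] at ht
        rw [abs_of_nonpos ht.2, abs_of_nonpos h]; linarith [ht.1]
  have key : ∀ T : ℝ, (∫ x in -T..T, K (x + y * Complex.I)) = (∫ x in -T..T, K x) +
      Complex.I • (∫ t in (0 : ℝ)..y, K (((1 * T : ℝ) : ℂ) + t * Complex.I)) -
      Complex.I • (∫ t in (0 : ℝ)..y, K (((-1 * T : ℝ) : ℂ) + t * Complex.I)) := by
    intro T
    have h := Complex.integral_boundary_rect_eq_zero_of_differentiableOn K (-T : ℝ)
      (T + y * Complex.I) hK.differentiableOn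
    simp only [Complex.ofReal_re, Complex.ofReal_im, Complex.add_re, Complex.mul_re, Complex.I_re,
      Complex.I_im, Complex.add_im, Complex.mul_im, mul_zero, mul_one, zero_mul, sub_zero, add_zero,
      zero_add, Complex.ofReal_zero] at h
    rw [one_mul, neg_one_mul]
    linear_combination (exp := 1) -h
  refine tendsto_nhds_unique htop ?_
  simp only [id, key]
  simpa using (hbot.add ((hside 1 (by norm_num)).const_smul Complex.I)).sub
    ((hside (-1) (by norm_num)).const_smul Complex.I)

/-- The mean value property over the unit disc. The area integral is invariant under rotations of
the disc, and averaging over all rotations replaces `G` by its circle averages. -/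
theorem integral_ball_one_eq {G : ℂ → ℂ} (hG : Differentiable ℂ G) :
    ∫ z in Metric.ball (0 : ℂ) 1, G z = Real.pi * G 0 := by
  have hrot : ∀ t : ℝ, ∫ z in Metric.ball (0 : ℂ) 1, G (circleMap 0 1 t * z) =
      ∫ z in Metric.ball (0 : ℂ) 1, G z := by
    intro t
    let u : Circle := Circle.exp t
    have hu : (u : ℂ) = circleMap 0 1 t := by simp [u, circleMap]
    have h := (rotation u).measurePreserving.setIntegral_preimage_emb
      (rotation u).toHomeomorph.measurableEmbedding G (Metric.ball (0 : ℂ) 1)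
    have hpre : (rotation u) ⁻¹' Metric.ball (0 : ℂ) 1 = Metric.ball 0 1 := by
      ext z; simp [-LinearIsometryEquiv.preimage_ball, -rotation_apply]
    rw [hpre] at h
    simpa [hu] using h
  have havg : ∀ z : ℂ, ∫ t in (0 : ℝ)..2 * Real.pi, G (circleMap 0 1 t * z) =
      2 * Real.pi * G 0 := by
    intro z
    have hd : DiffContOnCl ℂ (fun w => G (w * z)) (Metric.ball 0 |1|) :=
      Differentiable.diffContOnCl (by fun_prop)
    have h := hd.circleAverage
    rw [Real.circleAverage_def, zero_mul] at h
    rw [← h, Complex.real_smul]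
    push_cast
    rw [mul_inv_cancel_left₀ (by simp [Real.pi_ne_zero])]
  have hswap : ∫ t in (0 : ℝ)..2 * Real.pi, ∫ z in Metric.ball (0 : ℂ) 1, G (circleMap 0 1 t * z) =
      ∫ z in Metric.ball (0 : ℂ) 1, ∫ t in (0 : ℝ)..2 * Real.pi, G (circleMap 0 1 t * z) := by
    simp only [intervalIntegral.integral_of_le Real.two_pi_pos.le]
    refine integral_integral_swap ?_
    rw [Measure.prod_restrict]
    have hcont : Continuous (Function.uncurry fun (t : ℝ) (z : ℂ) => G (circleMap 0 1 t * z)) :=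
      hG.continuous.comp (((continuous_circleMap 0 1).comp continuous_fst).mul continuous_snd)
    exact (hcont.continuousOn.integrableOn_compact
      (isCompact_Icc.prod (isCompact_closedBall (0 : ℂ) 1))).mono_set
      (Set.prod_mono Set.Ioc_subset_Icc_self Metric.ball_subset_closedBall)
  simp only [hrot, havg, intervalIntegral.integral_const, setIntegral_const, sub_zero,
    Complex.real_smul, Measure.real, Complex.volume_ball] at hswap
  have hpi : (Real.pi : ℂ) ≠ 0 := by exact_mod_cast Real.pi_ne_zero
  simp at hswap
  refine mul_left_cancel₀ (mul_ne_zero two_ne_zero hpi) ?_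
  rw [hswap]; ring

/-- The sub-mean value property over unit discs of the square of the modulus of an entire
function. -/
theorem pi_mul_sq_norm_le_integral_ball {F : ℂ → ℂ} (hF : Differentiable ℂ F) (z₀ : ℂ) :
    Real.pi * ‖F z₀‖ ^ 2 ≤ ∫ z in Metric.ball z₀ 1, ‖F z‖ ^ 2 := by
  have h := integral_ball_one_eq (G := fun z => F (z + z₀) ^ 2) (by fun_prop)
  have h2 : ‖∫ z in Metric.ball (0 : ℂ) 1, F (z + z₀) ^ 2‖ ≤
      ∫ z in Metric.ball (0 : ℂ) 1, ‖F (z + z₀)‖ ^ 2 := by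
    simp_rw [← norm_pow]
    exact norm_integral_le_integral_norm _
  rw [h, norm_mul, zero_add, norm_pow, Complex.norm_real, Real.norm_of_nonneg Real.pi_pos.le] at h2
  refine h2.trans_eq ?_
  have h3 := (measurePreserving_add_right volume z₀).setIntegral_preimage_emb
      (measurableEmbedding_addRight z₀) (fun z => ‖F z‖ ^ 2) (Metric.ball z₀ 1)
  have hpre : (fun z => z + z₀) ⁻¹' Metric.ball z₀ 1 = Metric.ball 0 1 := by
    ext z; simp [dist_eq_norm]
  rwa [hpre] at h3

/-! ### Hermite polynomials and Gaussian integrals -/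

theorem derivative_hermiteH (k : ℕ) :
    derivative (hermiteH k) = 2 * (k : ℤ[X]) * hermiteH (k - 1) := by
  induction k using Nat.strong_induction_on with
  | _ k ih =>
    match k with
    | 0 => simp [hermiteH]
    | 1 => simp [hermiteH]
    | k + 2 =>
      have h1 := ih (k + 1) (by omega)
      have h0 := ih k (by omega)
      have hs : hermiteH (k + 2) = 2 * X * hermiteH (k + 1) - derivative (hermiteH (k + 1)) := rfl
      have hs1 : hermiteH (k + 1) = 2 * X * hermiteH k - derivative (hermiteH k) := rfl
      have h2 : derivative (2 : ℤ[X]) = 0 := derivative_ofNat 2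
      have h3 : derivative ((k : ℤ[X]) + 1) = 0 := by simp
      simp only [Nat.add_sub_cancel, Nat.cast_add, Nat.cast_one, Nat.cast_ofNat,
        show k + 2 - 1 = k + 1 by omega] at h1 ⊢
      rw [hs, h1]
      simp only [derivative_sub, derivative_mul, derivative_X, h2, h3, h1]
      linear_combination (-2 * ((k : ℤ[X]) + 1)) * hs1

theorem hermiteH_succ (k : ℕ) :
    hermiteH (k + 1) = 2 * X * hermiteH k - 2 * (k : ℤ[X]) * hermiteH (k - 1) := by
  rw [← derivative_hermiteH]; rfl

/-- The Hermite polynomials with complex coefficients. -/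
def hermiteC (k : ℕ) : ℂ[X] := (hermiteH k).map (algebraMap ℤ ℂ)

theorem hermiteC_zero : hermiteC 0 = 1 := by simp [hermiteC, hermiteH]

theorem hermiteC_succ (k : ℕ) :
    hermiteC (k + 1) = 2 * X * hermiteC k - 2 * (k : ℂ[X]) * hermiteC (k - 1) := by
  simp [hermiteC, hermiteH_succ k]

theorem derivative_hermiteC (k : ℕ) :
    derivative (hermiteC k) = 2 * (k : ℂ[X]) * hermiteC (k - 1) := by
  simp [hermiteC, derivative_map, derivative_hermiteH k]

theorem aeval_hermiteH (k : ℕ) (z : ℂ) : aeval z (hermiteH k) = (hermiteC k).eval z := by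
  rw [hermiteC, eval_map_algebraMap]

theorem ofReal_aeval_hermiteH (k : ℕ) (x : ℝ) :
    ((aeval x (hermiteH k) : ℝ) : ℂ) = (hermiteC k).eval (x : ℂ) := by
  rw [← aeval_hermiteH]
  exact (aeval_algebraMap_apply ℂ x (hermiteH k)).symm

theorem conj_eval_hermiteC (k : ℕ) (z : ℂ) :
    (starRingEnd ℂ) ((hermiteC k).eval z) = (hermiteC k).eval ((starRingEnd ℂ) z) := by
  rw [← aeval_hermiteH, ← aeval_hermiteH]
  simp only [aeval_def]
  rw [hom_eval₂]
  congr 1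
  exact RingHom.ext_int _ _

theorem exists_norm_eval_le_mul_exp (p : ℂ[X]) {ε : ℝ} (hε : 0 < ε) :
    ∃ C : ℝ, 0 ≤ C ∧ ∀ z : ℂ, ‖p.eval z‖ ≤ C * Real.exp (ε * ‖z‖ ^ 2) := by
  induction p using Polynomial.induction_on' with
  | add p q hp hq =>
    obtain ⟨C, hC, h⟩ := hp
    obtain ⟨D, hD, h'⟩ := hq
    refine ⟨C + D, by positivity, fun z => ?_⟩
    rw [eval_add, add_mul]
    exact (norm_add_le _ _).trans (add_le_add (h z) (h' z))
  | monomial n a =>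
    refine ⟨‖a‖ * (1 + n.factorial / ε ^ n), by positivity, fun z => ?_⟩
    rw [eval_monomial, norm_mul, norm_pow, mul_assoc]
    gcongr
    have h1 : (1 : ℝ) ≤ Real.exp (ε * ‖z‖ ^ 2) := Real.one_le_exp (by positivity)
    have h2 := Real.pow_div_factorial_le_exp (ε * ‖z‖ ^ 2) (by positivity) n
    have h3 : (‖z‖ ^ 2) ^ n ≤ n.factorial / ε ^ n * Real.exp (ε * ‖z‖ ^ 2) := by
      rw [mul_pow, div_le_iff₀ (by positivity)] at h2
      rw [div_mul_eq_mul_div, le_div_iff₀ (by positivity)]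
      linarith
    have h4 : ‖z‖ ^ n ≤ 1 + (‖z‖ ^ 2) ^ n := by
      rw [← pow_mul, mul_comm 2 n, pow_mul]
      nlinarith [sq_nonneg (‖z‖ ^ n - 1), sq_nonneg (‖z‖ ^ n)]
    linarith

theorem integrable_eval_mul_exp (p : ℂ[X]) {γ : ℝ} (hγ : 0 < γ) :
    Integrable fun u : ℝ => p.eval (u : ℂ) * (Real.exp (-γ * u ^ 2) : ℂ) := by
  obtain ⟨C, hC, h⟩ := exists_norm_eval_le_mul_exp p (half_pos hγ)
  refine ((integrable_exp_neg_mul_sq (half_pos hγ)).const_mul C).mono'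
    (Continuous.aestronglyMeasurable (by fun_prop)) (.of_forall fun u => ?_)
  rw [norm_mul, Complex.norm_real, Real.norm_of_nonneg (Real.exp_pos _).le]
  refine (mul_le_mul_of_nonneg_right (h u) (Real.exp_pos _).le).trans_eq ?_
  rw [mul_assoc, ← Real.exp_add, Complex.norm_real, Real.norm_eq_abs, sq_abs]
  ring_nf

/-- The functional `p ↦ ∫ p(u) exp(-γ u²) du` on polynomials. -/
def gaussianFunctional {γ : ℝ} (hγ : 0 < γ) : ℂ[X] →ₗ[ℂ] ℂ where
  toFun p := ∫ u : ℝ, p.eval (u : ℂ) * (Real.exp (-γ * u ^ 2) : ℂ)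
  map_add' p q := by
    simp only [eval_add, add_mul]
    exact integral_add (integrable_eval_mul_exp p hγ) (integrable_eval_mul_exp q hγ)
  map_smul' a p := by
    simp only [eval_smul, smul_eq_mul, mul_assoc, RingHom.id_apply]
    exact integral_const_mul _ _

theorem gaussianFunctional_apply {γ : ℝ} (hγ : 0 < γ) (p : ℂ[X]) :
    gaussianFunctional hγ p = ∫ u : ℝ, p.eval (u : ℂ) * (Real.exp (-γ * u ^ 2) : ℂ) := rfl

theorem gaussianFunctional_C_mul {γ : ℝ} (hγ : 0 < γ) (a : ℂ) (p : ℂ[X]) :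
    gaussianFunctional hγ (C a * p) = a * gaussianFunctional hγ p := by
  rw [← smul_eq_C_mul, map_smul, smul_eq_mul]

/-- Integration by parts against a Gaussian. -/
theorem gaussianFunctional_derivative {γ : ℝ} (hγ : 0 < γ) (p : ℂ[X]) :
    gaussianFunctional hγ (derivative p) = 2 * γ * gaussianFunctional hγ (X * p) := by
  have hd : ∀ u : ℝ, HasDerivAt (fun u : ℝ => p.eval (u : ℂ) * (Real.exp (-γ * u ^ 2) : ℂ))
      ((derivative p).eval (u : ℂ) * (Real.exp (-γ * u ^ 2) : ℂ) -
        2 * γ * ((X * p).eval (u : ℂ) * (Real.exp (-γ * u ^ 2) : ℂ))) u := by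
    intro u
    have h1 : HasDerivAt (fun u : ℝ => p.eval (u : ℂ)) ((derivative p).eval (u : ℂ)) u :=
      (p.hasDerivAt (u : ℂ)).comp_ofReal
    have h2 : HasDerivAt (fun u : ℝ => Real.exp (-γ * u ^ 2))
        (Real.exp (-γ * u ^ 2) * (-γ * (2 * u))) u := by
      simpa using (((hasDerivAt_id u).pow 2).const_mul (-γ)).exp
    convert! h1.mul h2.ofReal_comp using 1
    simp only [eval_mul, eval_X]
    push_cast
    ring
  have hi := (integrable_eval_mul_exp (derivative p) hγ)
  have hi2 := (integrable_eval_mul_exp (X * p) hγ).const_mul (2 * γ : ℂ)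
  have h := integral_eq_zero_of_hasDerivAt_of_integrable hd (hi.sub hi2)
    (integrable_eval_mul_exp p hγ)
  rw [integral_sub hi hi2, integral_const_mul] at h
  exact sub_eq_zero.mp h

theorem gaussianFunctional_one {γ : ℝ} (hγ : 0 < γ) :
    gaussianFunctional hγ 1 = (√(Real.pi / γ) : ℂ) := by
  simp only [gaussianFunctional_apply, eval_one, one_mul]
  rw [integral_complex_ofReal, integral_gaussian]

/-- Orthogonality of the Hermite polynomials on the real line. -/
theorem gaussianFunctional_hermiteC_mul_hermiteC (k m : ℕ) :
    gaussianFunctional one_pos (hermiteC k * hermiteC m) =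
      if k = m then ((2 ^ k * k.factorial * √Real.pi : ℝ) : ℂ) else 0 := by
  have hrec : ∀ k m : ℕ, gaussianFunctional one_pos (hermiteC k * hermiteC (m + 1)) =
      2 * k * gaussianFunctional one_pos (hermiteC (k - 1) * hermiteC m) := by
    intro k m
    have h := gaussianFunctional_derivative one_pos (hermiteC k * hermiteC m)
    have e : hermiteC k * hermiteC (m + 1) = C (2 : ℂ) * (X * (hermiteC k * hermiteC m)) -
        derivative (hermiteC k * hermiteC m) + C (2 * k : ℂ) * (hermiteC (k - 1) * hermiteC m) := by
      rw [derivative_mul, derivative_hermiteC, derivative_hermiteC, hermiteC_succ]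
      simp only [map_mul, map_ofNat, map_natCast]
      ring
    rw [e, map_add, map_sub, gaussianFunctional_C_mul, gaussianFunctional_C_mul, h]
    push_cast
    ring
  induction m generalizing k with
  | zero =>
    match k with
    | 0 =>
      simp [hermiteC_zero, gaussianFunctional_one]
    | k + 1 =>
      rw [if_neg (by omega)]
      simpa [mul_comm] using hrec 0 k
  | succ m ih =>
    rw [hrec, ih]
    match k with
    | 0 => simp
    | k + 1 =>
      by_cases h : k = m
      · simp only [h, Nat.add_sub_cancel, if_true]
        rw [Nat.factorial_succ]
        push_cast
        ring
      · simp [h]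

/-- Averaging `H_k(θ z - 2 i u)` over a Gaussian variable `u` of variance `(θ ^ 2 - 1) / 8` gives
`θ ^ k H_k(z)`: both sides satisfy the same three-term recurrence. -/
theorem gaussianFunctional_hermiteC_comp {θ : ℝ} (hγ : 0 < 4 / (θ ^ 2 - 1)) (k : ℕ) (z : ℂ) :
    gaussianFunctional hγ ((hermiteC k).comp (C (θ * z) - C (2 * Complex.I) * X)) =
      √(Real.pi * (θ ^ 2 - 1) / 4) * θ ^ k * (hermiteC k).eval z := by
  have hθ2 : ((θ : ℂ) ^ 2 - 1) ≠ 0 := by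
    have : θ ^ 2 - 1 ≠ 0 := by
      intro h
      simp [h] at hγ
    exact_mod_cast this
  let P : ℕ → ℂ[X] := fun k => (hermiteC k).comp (C (θ * z) - C (2 * Complex.I) * X)
  change gaussianFunctional hγ (P k) = _
  induction k using Nat.strong_induction_on with
  | _ k ih =>
    match k with
    | 0 =>
      simp only [P, hermiteC_zero, one_comp, eval_one, gaussianFunctional_one, pow_zero, mul_one]
      congr 2
      field_simp
    | k + 1 =>
      have h := gaussianFunctional_derivative hγ (P k)
      have hd : derivative (P k) = C (-4 * Complex.I * k) * P (k - 1) := by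
        simp only [P]
        rw [derivative_comp, derivative_hermiteC]
        simp only [derivative_sub, derivative_C, derivative_mul, derivative_X, mul_comp,
          map_mul, map_neg, map_natCast, natCast_comp, ofNat_comp]
        simp only [map_ofNat]
        ring
      have hs : P (k + 1) = C (2 * θ * z) * P k - C (4 * Complex.I) * (X * P k) -
          C (2 * k : ℂ) * P (k - 1) := by
        simp only [P]
        rw [hermiteC_succ]
        simp only [sub_comp, mul_comp, X_comp, natCast_comp, ofNat_comp, map_mul, map_natCast]
        simp only [map_ofNat]
        ring
      have hprev : (k : ℂ) * gaussianFunctional hγ (P (k - 1)) =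
          k * (√(Real.pi * (θ ^ 2 - 1) / 4) * θ ^ (k - 1) * (hermiteC (k - 1)).eval z) := by
        rcases Nat.eq_zero_or_pos k with rfl | hk
        · simp
        · rw [ih (k - 1) (by omega)]
      have hpow : (k : ℂ) * θ ^ (k + 1) = k * θ ^ 2 * θ ^ (k - 1) := by
        rcases Nat.eq_zero_or_pos k with rfl | hk
        · simp
        · rw [mul_assoc, ← pow_add]; congr 2; omega
      rw [hd, gaussianFunctional_C_mul, mul_assoc, hprev] at h
      have h8 : (2 * ((4 / (θ ^ 2 - 1) : ℝ) : ℂ)) * ((θ ^ 2 - 1) / 8) = 1 := by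
        push_cast
        field_simp
        norm_num
      rw [hs, map_sub, map_sub, gaussianFunctional_C_mul, gaussianFunctional_C_mul,
        gaussianFunctional_C_mul, mul_assoc 2 (k : ℂ), hprev, ih k (by omega), hermiteC_succ]
      simp only [eval_sub, eval_mul, eval_X, eval_ofNat, eval_natCast]
      linear_combination (4 * Complex.I * ((θ ^ 2 - 1) / 8)) * h +
        (4 * Complex.I * gaussianFunctional hγ (X * P k)) * h8 +
        (2 * √(Real.pi * (θ ^ 2 - 1) / 4) * (hermiteC (k - 1)).eval z) * hpow +
        (2 * (θ ^ 2 - 1) * (k * (√(Real.pi * (θ ^ 2 - 1) / 4) * θ ^ (k - 1) *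
          (hermiteC (k - 1)).eval z))) * Complex.I_sq

/-! ### Growth of entire functions in the weighted Bergman space -/

/-- The quadratic form with `areaWeight θ z = exp (-2 * weightForm θ z)`. -/
def weightForm (θ : ℝ) (z : ℂ) : ℝ := z.re ^ 2 / (θ + 1) + z.im ^ 2 / (θ - 1)

theorem areaWeight_eq (θ : ℝ) (z : ℂ) : areaWeight θ z = Real.exp (-2 * weightForm θ z) := rfl

@[fun_prop]
theorem continuous_weightForm (θ : ℝ) : Continuous (weightForm θ) := by
  unfold weightForm; fun_prop

@[fun_prop]
theorem continuous_areaWeight (θ : ℝ) : Continuous (areaWeight θ) := by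
  unfold areaWeight; fun_prop

/-- The growth `‖F z‖ = O(exp (3/2 * weightForm θ z))`. An entire `F` that is square integrable
against `areaWeight θ` satisfies such a bound with any constant above `1` in place of `3/2`, and any
constant below `2` makes `F` times a polynomial integrable against `areaWeight θ`. -/
def HasModerateGrowth (θ : ℝ) (F : ℂ → ℂ) : Prop :=
  ∃ C : ℝ, 0 ≤ C ∧ ∀ z, ‖F z‖ ≤ C * Real.exp (3 / 2 * weightForm θ z)

/-- Point evaluations are bounded on the weighted Bergman space: `1 / areaWeight θ` is bounded on
the unit disc around `z`, where the sub-mean value property applies. -/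
theorem sq_norm_le_of_integrable {θ δ : ℝ} (hθ : 1 < θ) (hδ : 0 < δ) {F : ℂ → ℂ}
    (hF : Differentiable ℂ F) (hi : Integrable fun z : ℂ => ‖F z‖ ^ 2 * areaWeight θ z) (z : ℂ) :
    ‖F z‖ ^ 2 ≤ (Real.exp (2 * (1 + 1 / δ) * (1 / (θ + 1) + 1 / (θ - 1))) *
      ∫ z : ℂ, ‖F z‖ ^ 2 * areaWeight θ z) * Real.exp (2 * (1 + δ) * weightForm θ z) := by
  have hp : 0 < θ + 1 := by linarith
  have hm : 0 < θ - 1 := by linarith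
  set M := Real.exp (2 * (1 + 1 / δ) * (1 / (θ + 1) + 1 / (θ - 1))) *
    Real.exp (2 * (1 + δ) * weightForm θ z) with hM
  have hsq : ∀ a b : ℝ, |a - b| ≤ 1 → a ^ 2 ≤ (1 + 1 / δ) + (1 + δ) * b ^ 2 := by
    intro a b h
    have h1 : (a - b) ^ 2 ≤ 1 := by rw [← sq_abs]; exact pow_le_one₀ (abs_nonneg _) h
    -- Young's inequality for `a = (a - b) + b`, with its defect made explicit
    have h2 : a ^ 2 = (1 + 1 / δ) * (a - b) ^ 2 + (1 + δ) * b ^ 2 -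
        1 / δ * (a - b - δ * b) ^ 2 := by
      field_simp
      ring
    have h3 : 0 ≤ 1 / δ * (a - b - δ * b) ^ 2 := by positivity
    have h4 : (1 + 1 / δ) * (a - b) ^ 2 ≤ 1 + 1 / δ :=
      mul_le_of_le_one_right (by positivity) h1
    linarith
  have hw : ∀ v ∈ Metric.ball z 1, ‖F v‖ ^ 2 ≤ M * (‖F v‖ ^ 2 * areaWeight θ v) := by
    intro v hv
    rw [Metric.mem_ball, dist_eq_norm] at hv
    have hre := hsq v.re z.re ((Complex.abs_re_le_norm (v - z)).trans hv.le)
    have him := hsq v.im z.im ((Complex.abs_im_le_norm (v - z)).trans hv.le)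
    have h1 : 1 ≤ M * areaWeight θ v := by
      rw [hM, areaWeight_eq, ← Real.exp_add, ← Real.exp_add]
      refine Real.one_le_exp ?_
      have h2 := div_le_div_of_nonneg_right hre hp.le
      have h3 := div_le_div_of_nonneg_right him hm.le
      unfold weightForm
      simp only [add_div, mul_div_assoc] at h2 h3 ⊢
      have e1 : ∀ c : ℝ, (1 + 1 / δ) * (1 / c) = 1 / c + 1 / δ / c := fun c => by ring
      linarith [e1 (θ + 1), e1 (θ - 1)]
    nlinarith [sq_nonneg ‖F v‖]
  have hcont : Continuous fun v => ‖F v‖ ^ 2 := by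
    have := hF.continuous
    fun_prop
  have h1 : ∫ v in Metric.ball z 1, ‖F v‖ ^ 2 ≤
      ∫ v in Metric.ball z 1, M * (‖F v‖ ^ 2 * areaWeight θ v) :=
    setIntegral_mono_on
      ((hcont.continuousOn.integrableOn_compact (isCompact_closedBall z 1)).mono_set
        Metric.ball_subset_closedBall) (hi.const_mul M).integrableOn measurableSet_ball hw
  have h2 : ∫ v in Metric.ball z 1, M * (‖F v‖ ^ 2 * areaWeight θ v) ≤
      M * ∫ v, ‖F v‖ ^ 2 * areaWeight θ v := by
    rw [← integral_const_mul]
    exact setIntegral_le_integral (hi.const_mul M) (.of_forall fun v => by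
      simp only [Pi.zero_apply, hM, areaWeight_eq]; positivity)
  have h3 := pi_mul_sq_norm_le_integral_ball hF z
  have h4 : ‖F z‖ ^ 2 ≤ Real.pi * ‖F z‖ ^ 2 := by
    nlinarith [Real.pi_gt_three, sq_nonneg ‖F z‖]
  calc ‖F z‖ ^ 2 ≤ M * ∫ v, ‖F v‖ ^ 2 * areaWeight θ v := by linarith
    _ = _ := by rw [hM]; ring

theorem hasModerateGrowth_of_integrable {θ : ℝ} (hθ : 1 < θ) {F : ℂ → ℂ}
    (hF : Differentiable ℂ F) (hi : Integrable fun z : ℂ => ‖F z‖ ^ 2 * areaWeight θ z) :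
    HasModerateGrowth θ F := by
  refine ⟨√(Real.exp (2 * (1 + 1 / (1 / 2)) * (1 / (θ + 1) + 1 / (θ - 1))) *
      ∫ z : ℂ, ‖F z‖ ^ 2 * areaWeight θ z), Real.sqrt_nonneg _, fun z => ?_⟩
  refine abs_le_of_sq_le_sq' ?_ (by positivity) |>.2
  have h := sq_norm_le_of_integrable hθ one_half_pos hF hi z
  rw [mul_pow, Real.sq_sqrt]
  · refine h.trans_eq ?_
    rw [← Real.exp_nat_mul]
    congr 2
    push_cast; ring
  · exact mul_nonneg (Real.exp_pos _).le (integral_nonneg fun v => by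
      simp only [areaWeight_eq, Pi.zero_apply]; positivity)

theorem norm_sq_div_le_weightForm {θ : ℝ} (hθ : 1 < θ) (z : ℂ) :
    ‖z‖ ^ 2 / (θ + 1) ≤ weightForm θ z := by
  rw [Complex.sq_norm, Complex.normSq_apply, weightForm, ← sq, ← sq, add_div]
  have h : 0 < θ - 1 := by linarith
  gcongr
  linarith

theorem exists_norm_eval_le_mul_exp_weightForm {θ : ℝ} (hθ : 1 < θ) (p : ℂ[X]) {ε : ℝ}
    (hε : 0 < ε) : ∃ C : ℝ, 0 ≤ C ∧ ∀ z, ‖p.eval z‖ ≤ C * Real.exp (ε * weightForm θ z) := by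
  obtain ⟨C, hC, h⟩ := exists_norm_eval_le_mul_exp p
    (show 0 < ε / (θ + 1) from div_pos hε (by linarith))
  refine ⟨C, hC, fun z => (h z).trans (mul_le_mul_of_nonneg_left (Real.exp_le_exp.mpr ?_) hC)⟩
  rw [div_mul_eq_mul_div, mul_div_assoc]
  exact mul_le_mul_of_nonneg_left (norm_sq_div_le_weightForm hθ z) hε.le

theorem hasModerateGrowth_eval {θ : ℝ} (hθ : 1 < θ) (p : ℂ[X]) :
    HasModerateGrowth θ fun z => p.eval z :=
  exists_norm_eval_le_mul_exp_weightForm hθ p (by norm_num)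

theorem integrable_exp_neg_weightForm {θ : ℝ} (hθ : 1 < θ) {κ : ℝ} (hκ : 0 < κ) :
    Integrable fun z => Real.exp (-κ * weightForm θ z) := by
  have h1 := integrable_exp_neg_mul_sq (show 0 < κ / (θ + 1) from div_pos hκ (by linarith))
  have h2 := integrable_exp_neg_mul_sq (show 0 < κ / (θ - 1) from div_pos hκ (by linarith))
  have h := (Complex.volume_preserving_equiv_real_prod.integrable_comp_emb
    Complex.measurableEquivRealProd.measurableEmbedding).mpr (h1.mul_prod h2)
  refine h.congr (.of_forall fun z => ?_)
  simp only [Function.comp_apply, Complex.measurableEquivRealProd_apply, ← Real.exp_add]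
  unfold weightForm
  congr 1
  ring

theorem integral_complex_eq_integral_integral {Φ : ℂ → ℂ} (hΦ : Integrable Φ) :
    ∫ z, Φ z = ∫ y : ℝ, ∫ x : ℝ, Φ (x + y * Complex.I) := by
  have hmp := Complex.volume_preserving_equiv_real_prod.symm
  have hi := (hmp.integrable_comp_emb
    Complex.measurableEquivRealProd.symm.measurableEmbedding).mpr hΦ
  have h := hmp.integral_comp' Φ
  rw [← h, Measure.volume_eq_prod]
  rw [Measure.volume_eq_prod] at hi
  refine (integral_prod_symm _ hi).trans ?_
  simp only [Function.comp_apply, Complex.measurableEquivRealProd_symm_apply,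
    Complex.mk_eq_add_mul_I]

/-! ### Reproducing Hermite coefficients by area integrals -/

/-- The vertical Gaussian average of `H_k`. Completing the square and shifting the contour by
`-(θ - 1) x / 2` turns it into the average of `gaussianFunctional_hermiteC_comp`. -/
theorem integral_hermiteC_vertical {θ : ℝ} (hθ : 1 < θ) (k : ℕ) (x : ℝ) :
    ∫ y : ℝ, (hermiteC k).eval (x - 2 * y * Complex.I) *
        Complex.exp (-2 * ((x - y * Complex.I) ^ 2 / (θ + 1) + y ^ 2 / (θ - 1))) =
      √(Real.pi * (θ ^ 2 - 1) / 4) * θ ^ k *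
        ((hermiteC k).eval (x : ℂ) * (Real.exp (-x ^ 2) : ℂ)) := by
  have hγ : 0 < 4 / (θ ^ 2 - 1) := div_pos (by norm_num) (by nlinarith)
  have hp : (θ : ℂ) + 1 ≠ 0 := by
    have : θ + 1 ≠ 0 := by linarith
    exact_mod_cast this
  have hm : (θ : ℂ) - 1 ≠ 0 := by
    have : θ - 1 ≠ 0 := by linarith
    exact_mod_cast this
  have hfac : (θ : ℂ) ^ 2 - 1 = (θ + 1) * (θ - 1) := by ring
  set γ : ℝ := 4 / (θ ^ 2 - 1) with hγ_def
  -- On the line of height `t` the function `K` below is the given integrand; on the real axis it is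
  -- the integrand of a centred Gaussian average.
  let t : ℝ := -(θ - 1) * x / 2
  let p : ℂ[X] := (hermiteC k).comp (C (θ * x : ℂ) - C (2 * Complex.I) * X)
  let K : ℂ → ℂ := fun u => p.eval u * Complex.exp (-γ * u ^ 2 - x ^ 2)
  have hK : Differentiable ℂ K := p.differentiable.mul (by fun_prop)
  obtain ⟨D, hD, hbound⟩ := exists_norm_eval_le_mul_exp p (half_pos hγ)
  have hdecay : ∀ u τ : ℝ, |τ| ≤ |t| →
      ‖K (u + τ * Complex.I)‖ ≤ D * Real.exp (3 / 2 * γ * t ^ 2) * Real.exp (-(γ / 2) * u ^ 2) := by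
    intro u τ hτ
    have hτ2 : τ ^ 2 ≤ t ^ 2 := sq_le_sq.mpr hτ
    have h1 := hbound (u + τ * Complex.I)
    have h2 : ‖Complex.exp (-γ * (u + τ * Complex.I) ^ 2 - x ^ 2)‖ =
        Real.exp (-γ * (u ^ 2 - τ ^ 2) - x ^ 2) := by
      rw [Complex.norm_exp]
      simp [sq]
    rw [Complex.sq_norm, Complex.normSq_add_mul_I] at h1
    simp only [K, norm_mul, h2]
    refine (mul_le_mul_of_nonneg_right h1 (Real.exp_pos _).le).trans ?_
    rw [mul_assoc, mul_assoc, ← Real.exp_add, ← Real.exp_add]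
    refine mul_le_mul_of_nonneg_left (Real.exp_le_exp.mpr ?_) hD
    nlinarith [sq_nonneg x, mul_le_mul_of_nonneg_left hτ2 hγ.le]
  have hshift := integral_add_mul_I_eq_integral hK (half_pos hγ) hdecay
  have hleft : ∀ y : ℝ, K (y + t * Complex.I) = (hermiteC k).eval (x - 2 * y * Complex.I) *
        Complex.exp (-2 * ((x - y * Complex.I) ^ 2 / (θ + 1) + y ^ 2 / (θ - 1))) := by
    intro y
    have harg : (θ * x : ℂ) - 2 * Complex.I * (y + t * Complex.I) = x - 2 * y * Complex.I := by
      simp only [t]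
      push_cast
      linear_combination ((θ - 1) * x : ℂ) * Complex.I_sq
    have hexp : -(γ : ℂ) * (y + t * Complex.I) ^ 2 - x ^ 2 =
        -2 * ((x - y * Complex.I) ^ 2 / (θ + 1) + y ^ 2 / (θ - 1)) := by
      simp only [t, hγ_def]
      push_cast
      rw [hfac]
      field_simp
      ring_nf
      simp only [Complex.I_sq]
      ring
    simp only [K, hexp]
    congr 1
    simp only [p, eval_comp, eval_sub, eval_mul, eval_C, eval_X, harg]
  have hright : ∀ u : ℝ, K u = (Real.exp (-x ^ 2) : ℂ) *
      (p.eval (u : ℂ) * (Real.exp (-γ * u ^ 2) : ℂ)) := by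
    intro u
    simp only [K]
    rw [sub_eq_add_neg, Complex.exp_add]
    push_cast
    ring
  simp only [hleft, hright, integral_const_mul] at hshift
  rw [hshift, ← gaussianFunctional_apply hγ, gaussianFunctional_hermiteC_comp hγ]
  ring

/-- Moving the horizontal lines of integration to the real axis. The antiholomorphic variable
`x - i y` becomes the holomorphic function `z - 2 i y` of `z = x + i y` for fixed `y`. -/
theorem integral_horizontal_shift {θ : ℝ} (hθ : 1 < θ) {F : ℂ → ℂ} (hF : Differentiable ℂ F)
    (hgr : HasModerateGrowth θ F) (p : ℂ[X]) (y : ℝ) :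
    ∫ x : ℝ, F (x + y * Complex.I) * p.eval (x - y * Complex.I) *
        (areaWeight θ (x + y * Complex.I) : ℂ) =
      ∫ x : ℝ, F x * (p.eval (x - 2 * y * Complex.I) *
        Complex.exp (-2 * ((x - y * Complex.I) ^ 2 / (θ + 1) + y ^ 2 / (θ - 1)))) := by
  obtain ⟨C, hC, hFb⟩ := hgr
  have hp : 0 < 1 / (θ + 1) := one_div_pos.mpr (by linarith)
  have hm : 0 < 1 / (θ - 1) := one_div_pos.mpr (by linarith)
  set r := 1 / (θ + 1) with hr
  set s := 1 / (θ - 1) with hs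
  obtain ⟨D, hD, hpb⟩ := exists_norm_eval_le_mul_exp p (show 0 < r / 4 by positivity)
  let K : ℂ → ℂ := fun z => F z * (p.eval (z - 2 * y * Complex.I) *
        Complex.exp (-2 * ((z - y * Complex.I) ^ 2 / (θ + 1) + y ^ 2 / (θ - 1))))
  have hK : Differentiable ℂ K :=
    hF.mul ((p.differentiable.comp (by fun_prop)).mul (by fun_prop))
  have hdecay : ∀ x t : ℝ, |t| ≤ |y| → ‖K (x + t * Complex.I)‖ ≤
      C * D * Real.exp ((12 * r + 2 * s) * y ^ 2) * Real.exp (-(r / 4) * x ^ 2) := by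
    intro x t ht
    have ht2 : t ^ 2 ≤ y ^ 2 := sq_le_sq.mpr ht
    have hty : (t - 2 * y) ^ 2 ≤ 9 * y ^ 2 := by
      nlinarith [abs_mul_abs_self (t - y), sq_nonneg (t + y)]
    have hty2 : (t - y) ^ 2 ≤ 4 * y ^ 2 := by nlinarith [sq_nonneg (t + y)]
    have h1 := hFb (x + t * Complex.I)
    have h2 := hpb (x + t * Complex.I - 2 * y * Complex.I)
    have harg : (x : ℂ) + t * Complex.I - 2 * y * Complex.I =
        x + ((t - 2 * y : ℝ) : ℂ) * Complex.I := by push_cast; ring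
    have hre : (-2 * (((x : ℂ) + t * Complex.I - y * Complex.I) ^ 2 / (θ + 1) +
        y ^ 2 / (θ - 1))).re = -2 * (r * (x ^ 2 - (t - y) ^ 2) + s * y ^ 2) := by
      have : -2 * (((x : ℂ) + t * Complex.I - y * Complex.I) ^ 2 / (θ + 1) + y ^ 2 / (θ - 1)) =
          ((-2 * (r * (x ^ 2 - (t - y) ^ 2) + s * y ^ 2) : ℝ) : ℂ) +
          ((-4 * r * x * (t - y) : ℝ) : ℂ) * Complex.I := by
        simp only [hr, hs]
        push_cast
        ring_nf
        simp only [Complex.I_sq]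
        ring
      rw [this, Complex.add_re, Complex.ofReal_re, Complex.re_ofReal_mul, Complex.I_re,
        mul_zero, add_zero]
    have hform : weightForm θ (x + t * Complex.I) = r * x ^ 2 + s * t ^ 2 := by
      simp [weightForm, hr, hs]; ring
    rw [hform] at h1
    rw [harg, Complex.sq_norm, Complex.normSq_add_mul_I, ← harg] at h2
    simp only [K, norm_mul, Complex.norm_exp, hre]
    calc _ ≤ (C * Real.exp (3 / 2 * (r * x ^ 2 + s * t ^ 2))) *
          ((D * Real.exp (r / 4 * (x ^ 2 + (t - 2 * y) ^ 2))) *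
            Real.exp (-2 * (r * (x ^ 2 - (t - y) ^ 2) + s * y ^ 2))) := by gcongr
      _ = C * D * Real.exp (3 / 2 * (r * x ^ 2 + s * t ^ 2) +
          r / 4 * (x ^ 2 + (t - 2 * y) ^ 2) +
            -2 * (r * (x ^ 2 - (t - y) ^ 2) + s * y ^ 2)) := by
        rw [Real.exp_add, Real.exp_add]; ring
      _ ≤ _ := by
        rw [mul_assoc (C * D), ← Real.exp_add]
        refine mul_le_mul_of_nonneg_left (Real.exp_le_exp.mpr ?_) (mul_nonneg hC hD)
        nlinarith [mul_le_mul_of_nonneg_left ht2 hm.le, mul_le_mul_of_nonneg_left hty hp.le,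
          mul_le_mul_of_nonneg_left hty2 hp.le, mul_nonneg hm.le (sq_nonneg y),
          mul_nonneg hp.le (sq_nonneg y)]
  rw [← integral_add_mul_I_eq_integral hK (show 0 < r / 4 by positivity) hdecay]
  refine integral_congr_ae (.of_forall fun x => ?_)
  have harg : (x : ℂ) + y * Complex.I - 2 * y * Complex.I = x - y * Complex.I := by ring
  have hw : (areaWeight θ (x + y * Complex.I) : ℂ) = Complex.exp (-2 *
      ((x + y * Complex.I - y * Complex.I) ^ 2 / (θ + 1) + y ^ 2 / (θ - 1))) := by
    rw [add_sub_cancel_right, areaWeight]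
    push_cast
    simp
  simp only [K, harg, hw]
  ring

/-- Pairing an entire function of moderate growth with `H_k` over the plane amounts to pairing it
with `H_k` over the real line. -/
theorem integral_mul_conj_hermiteC {θ : ℝ} (hθ : 1 < θ) {F : ℂ → ℂ} (hF : Differentiable ℂ F)
    (hgr : HasModerateGrowth θ F) (k : ℕ) :
    Integrable (fun z : ℂ => F z * (starRingEnd ℂ) ((hermiteC k).eval z) * (areaWeight θ z : ℂ)) ∧
    ∫ z : ℂ, F z * (starRingEnd ℂ) ((hermiteC k).eval z) * (areaWeight θ z : ℂ) =
      √(Real.pi * (θ ^ 2 - 1) / 4) * θ ^ k *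
        ∫ x : ℝ, F x * (hermiteC k).eval (x : ℂ) * (Real.exp (-x ^ 2) : ℂ) := by
  have hFc := hF.continuous
  have hint : Integrable
      fun z : ℂ => F z * (starRingEnd ℂ) ((hermiteC k).eval z) * (areaWeight θ z : ℂ) := by
    obtain ⟨C, hC, hFb⟩ := hgr
    obtain ⟨D, hD, hpb⟩ := exists_norm_eval_le_mul_exp_weightForm hθ (hermiteC k)
      (show (0 : ℝ) < 1 / 4 by norm_num)
    refine ((integrable_exp_neg_weightForm hθ (show (0 : ℝ) < 1 / 4 by norm_num)).const_mul
      (C * D)).mono' (Continuous.aestronglyMeasurable ?_) (.of_forall fun z => ?_)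
    · have := Complex.continuous_conj
      have h2 := (hermiteC k).continuous
      fun_prop
    · rw [norm_mul, norm_mul, Complex.norm_conj, Complex.norm_real, areaWeight_eq,
        Real.norm_of_nonneg (Real.exp_pos _).le]
      calc _ ≤ (C * Real.exp (3 / 2 * weightForm θ z)) * (D * Real.exp (1 / 4 * weightForm θ z)) *
            Real.exp (-2 * weightForm θ z) := by
            gcongr
            · exact hFb z
            · exact hpb z
        _ = C * D * Real.exp (3 / 2 * weightForm θ z + 1 / 4 * weightForm θ z +
            -2 * weightForm θ z) := by rw [Real.exp_add, Real.exp_add]; ring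
        _ = _ := by ring_nf
  refine ⟨hint, ?_⟩
  rw [integral_complex_eq_integral_integral hint]
  have hconj : ∀ x y : ℝ, (starRingEnd ℂ) ((hermiteC k).eval (x + y * Complex.I)) =
      (hermiteC k).eval (x - y * Complex.I) := by
    intro x y
    rw [conj_eval_hermiteC]
    simp [sub_eq_add_neg]
  simp only [hconj, integral_horizontal_shift hθ hF hgr]
  rw [integral_integral_swap]
  · simp only [integral_const_mul, integral_hermiteC_vertical hθ]
    rw [← integral_const_mul]
    refine integral_congr_ae (.of_forall fun x => ?_)
    ring
  · obtain ⟨C, hC, hFb⟩ := hgr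
    have hp : 0 < 1 / (θ + 1) := one_div_pos.mpr (by linarith)
    have hm : 0 < 1 / (θ - 1) := one_div_pos.mpr (by linarith)
    have hne : θ + 1 ≠ 0 := by linarith
    have hne' : θ - 1 ≠ 0 := by linarith
    have hrs : 1 / (θ - 1) - 1 / (θ + 1) = 2 * (1 / (θ + 1) * (1 / (θ - 1))) := by
      field_simp; ring
    set r := 1 / (θ + 1) with hr
    set s := 1 / (θ - 1) with hs
    -- The kernel decays like `exp (-2 r x² - 2 (s - r) y²)` with `s - r = 2 r s > 0`; `ε` is small
    -- enough for the polynomial factor not to spoil the decay in either variable.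
    set ε := min (r / 4) (r * s / 2) with hε_def
    have hε : 0 < ε := lt_min (by positivity) (by positivity)
    have hε1 : ε ≤ r / 4 := min_le_left _ _
    have hε2 : ε ≤ r * s / 2 := min_le_right _ _
    obtain ⟨D, hD, hpb⟩ := exists_norm_eval_le_mul_exp (hermiteC k) hε
    have hdom := ((integrable_exp_neg_mul_sq (show 0 < 2 * (r * s) by positivity)).mul_prod
      (integrable_exp_neg_mul_sq (show 0 < r / 4 by positivity))).const_mul (C * D)
    refine hdom.mono' (Continuous.aestronglyMeasurable ?_) (.of_forall fun ⟨y, x⟩ => ?_)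
    · have h2 := (hermiteC k).continuous
      simp only [Function.uncurry_def]
      fun_prop
    · have h1 := hFb x
      have h2 := hpb (x - 2 * y * Complex.I)
      have harg : (x : ℂ) - 2 * y * Complex.I = x + ((-2 * y : ℝ) : ℂ) * Complex.I := by
        push_cast; ring
      have hre : (-2 * (((x : ℂ) - y * Complex.I) ^ 2 / (θ + 1) +
          y ^ 2 / (θ - 1))).re = -2 * (r * (x ^ 2 - y ^ 2) + s * y ^ 2) := by
        have : -2 * (((x : ℂ) - y * Complex.I) ^ 2 / (θ + 1) + y ^ 2 / (θ - 1)) =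
            ((-2 * (r * (x ^ 2 - y ^ 2) + s * y ^ 2) : ℝ) : ℂ) +
            ((4 * r * x * y : ℝ) : ℂ) * Complex.I := by
          simp only [hr, hs]
          push_cast
          ring_nf
          simp only [Complex.I_sq]
          ring
        rw [this, Complex.add_re, Complex.ofReal_re, Complex.re_ofReal_mul, Complex.I_re,
        mul_zero, add_zero]
      have hform : weightForm θ (x : ℂ) = r * x ^ 2 := by
        simp [weightForm, hr]; ring
      rw [hform] at h1
      rw [harg, Complex.sq_norm, Complex.normSq_add_mul_I, ← harg] at h2
      simp only [Function.uncurry_apply_pair, norm_mul, Complex.norm_exp, hre]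
      calc _ ≤ (C * Real.exp (3 / 2 * (r * x ^ 2))) *
            ((D * Real.exp (ε * (x ^ 2 + (-2 * y) ^ 2))) *
              Real.exp (-2 * (r * (x ^ 2 - y ^ 2) + s * y ^ 2))) := by gcongr
        _ = C * D * Real.exp (3 / 2 * (r * x ^ 2) + ε * (x ^ 2 + (-2 * y) ^ 2) +
              -2 * (r * (x ^ 2 - y ^ 2) + s * y ^ 2)) := by
          rw [Real.exp_add, Real.exp_add]; ring
        _ ≤ C * D * Real.exp (-(2 * (r * s)) * y ^ 2 + -(r / 4) * x ^ 2) := by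
          refine mul_le_mul_of_nonneg_left (Real.exp_le_exp.mpr ?_) (mul_nonneg hC hD)
          have hsr : s = r + 2 * (r * s) := by linarith
          have e1 := mul_le_mul_of_nonneg_right hε1 (sq_nonneg x)
          have e2 := mul_le_mul_of_nonneg_right hε2 (sq_nonneg y)
          have e3 : s * y ^ 2 = r * y ^ 2 + 2 * (r * s) * y ^ 2 := by
            rw [← add_mul, ← hsr]
          linarith
        _ = _ := by rw [Real.exp_add]

/-! ### Square integrable functions for a weight -/

section Weight

variable {α : Type*} [MeasurableSpace α] {μ : Measure α} {ρ : α → ℝ}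

theorem integrable_withDensity_ofReal_iff (hρ : Measurable ρ) (hpos : ∀ x, 0 < ρ x) {g : α → ℂ} :
    Integrable g (μ.withDensity fun x => ENNReal.ofReal (ρ x)) ↔
      Integrable (fun x => g x * (ρ x : ℂ)) μ := by
  rw [integrable_withDensity_iff_integrable_smul' (by fun_prop) (by simp)]
  simp only [ENNReal.toReal_ofReal (hpos _).le, Complex.real_smul, mul_comm]

theorem integral_withDensity_ofReal (hρ : Measurable ρ) (hpos : ∀ x, 0 < ρ x) (g : α → ℂ) :
    ∫ x, g x ∂(μ.withDensity fun x => ENNReal.ofReal (ρ x)) = ∫ x, g x * (ρ x : ℂ) ∂μ := by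
  rw [integral_withDensity_eq_integral_toReal_smul (by fun_prop) (by simp)]
  simp only [ENNReal.toReal_ofReal (hpos _).le, Complex.real_smul, mul_comm]

theorem ae_withDensity_ofReal_iff (hρ : Measurable ρ) (hpos : ∀ x, 0 < ρ x) {p : α → Prop} :
    (∀ᵐ x ∂(μ.withDensity fun x => ENNReal.ofReal (ρ x)), p x) ↔ ∀ᵐ x ∂μ, p x := by
  rw [ae_withDensity_iff (by fun_prop)]
  simp [hpos]

theorem memLp_two_withDensity_ofReal_iff (hρ : Measurable ρ) (hpos : ∀ x, 0 < ρ x) {g : α → ℂ}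
    (hg : AEStronglyMeasurable g μ) :
    MemLp g 2 (μ.withDensity fun x => ENNReal.ofReal (ρ x)) ↔
      Integrable (fun x => ‖g x‖ ^ 2 * ρ x) μ := by
  rw [memLp_two_iff_integrable_sq_norm (hg.mono_ac (withDensity_absolutelyContinuous _ _)),
    integrable_withDensity_iff_integrable_smul' (by fun_prop) (by simp)]
  simp only [ENNReal.toReal_ofReal (hpos _).le, smul_eq_mul, mul_comm]

theorem inner_toLp_toLp {g h : α → ℂ} (hg : MemLp g 2 μ) (hh : MemLp h 2 μ) :
    inner ℂ (hg.toLp g) (hh.toLp h) = ∫ x, h x * (starRingEnd ℂ) (g x) ∂μ := by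
  rw [L2.inner_def]
  refine integral_congr_ae ?_
  filter_upwards [hg.coeFn_toLp, hh.coeFn_toLp] with x h1 h2
  rw [h1, h2, RCLike.inner_apply]

/-- If a series converges both in `L²` and pointwise, the two sums agree almost everywhere. -/
theorem ae_eq_of_hasSum_toLp {φ : ℕ → α → ℂ} (hφ : ∀ k, MemLp (φ k) 2 μ) {a : ℕ → ℂ}
    {g : Lp ℂ 2 μ} (hg : HasSum (fun k => a k • (hφ k).toLp (φ k)) g) {S : α → ℂ}
    (hS : ∀ x, HasSum (fun k => a k * φ k x) (S x)) : g =ᵐ[μ] S := by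
  obtain ⟨ns, hns, hlim⟩ :=
    (tendstoInMeasure_of_tendsto_Lp hg.tendsto_sum_nat).exists_seq_tendsto_ae
  have hcoe : ∀ n, (↑(∑ k ∈ Finset.range n, a k • (hφ k).toLp (φ k)) : α → ℂ) =ᵐ[μ]
      fun x => ∑ k ∈ Finset.range n, a k * φ k x := by
    intro n
    induction n with
    | zero =>
      simp only [Finset.range_zero, Finset.sum_empty]
      exact Lp.coeFn_zero ℂ 2 μ
    | succ n ih =>
      simp only [Finset.sum_range_succ]
      filter_upwards [Lp.coeFn_add (∑ k ∈ Finset.range n, a k • (hφ k).toLp (φ k))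
        (a n • (hφ n).toLp (φ n)), ih, Lp.coeFn_smul (a n) ((hφ n).toLp (φ n)),
        (hφ n).coeFn_toLp] with x h1 h2 h3 h4
      rw [h1, Pi.add_apply, h2, h3, Pi.smul_apply, h4, smul_eq_mul]
  filter_upwards [hlim, ae_all_iff.mpr hcoe] with x hx hc
  simp only [hc] at hx
  exact tendsto_nhds_unique hx ((hS x).tendsto_sum_nat.comp hns.tendsto_atTop)

end Weight

/-! ### Completeness of the Hermite polynomials -/

/-- The orthonormal Hermite polynomials as entire functions. -/
def hermiteONC (k : ℕ) (z : ℂ) : ℂ :=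
  (hermiteC k).eval z / (√(2 ^ k * (k.factorial : ℝ) * √Real.pi) : ℂ)

@[fun_prop]
theorem differentiable_hermiteONC (k : ℕ) : Differentiable ℂ (hermiteONC k) :=
  (hermiteC k).differentiable.div_const _

theorem ofReal_hermiteON (k : ℕ) (x : ℝ) : (hermiteON k x : ℂ) = hermiteONC k x := by
  rw [hermiteON, hermiteONC, Complex.ofReal_div, ofReal_aeval_hermiteH]

theorem conj_hermiteONC_ofReal (k : ℕ) (x : ℝ) :
    (starRingEnd ℂ) (hermiteONC k x) = hermiteONC k x := by
  rw [← ofReal_hermiteON, Complex.conj_ofReal]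

theorem sqrt_hermite_norm_pos (k : ℕ) : 0 < √(2 ^ k * (k.factorial : ℝ) * √Real.pi) :=
  Real.sqrt_pos.mpr (by positivity)

theorem integral_hermiteC_mul_hermiteC (k m : ℕ) :
    ∫ x : ℝ, (hermiteC k).eval (x : ℂ) * (hermiteC m).eval (x : ℂ) * (Real.exp (-x ^ 2) : ℂ) =
      if k = m then ((2 ^ k * k.factorial * √Real.pi : ℝ) : ℂ) else 0 := by
  rw [← gaussianFunctional_hermiteC_mul_hermiteC, gaussianFunctional_apply]
  simp only [eval_mul, neg_one_mul]

theorem integral_hermiteONC_mul_hermiteONC (k m : ℕ) :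
    ∫ x : ℝ, hermiteONC k x * hermiteONC m x * (Real.exp (-x ^ 2) : ℂ) =
      if k = m then 1 else 0 := by
  set N : ℕ → ℂ := fun k => (√(2 ^ k * (k.factorial : ℝ) * √Real.pi) : ℂ) with hN
  have hN0 : ∀ k, N k ≠ 0 := fun k => Complex.ofReal_ne_zero.mpr (sqrt_hermite_norm_pos k).ne'
  have h : ∀ x : ℝ, hermiteONC k x * hermiteONC m x * (Real.exp (-x ^ 2) : ℂ) =
      (N k * N m)⁻¹ * ((hermiteC k).eval (x : ℂ) * (hermiteC m).eval (x : ℂ) *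
        (Real.exp (-x ^ 2) : ℂ)) := by
    intro x
    simp only [hermiteONC, hN]
    rw [mul_inv]
    ring
  simp only [h, integral_const_mul, integral_hermiteC_mul_hermiteC]
  split_ifs with hkm
  · subst hkm
    have : N k * N k = ((2 ^ k * k.factorial * √Real.pi : ℝ) : ℂ) := by
      rw [hN, ← Complex.ofReal_mul, Real.mul_self_sqrt (by positivity)]
    rw [this]
    exact inv_mul_cancel₀ (by rw [← this]; exact mul_ne_zero (hN0 k) (hN0 k))
  · rw [mul_zero]

theorem measurable_exp_neg_sq : Measurable fun x : ℝ => Real.exp (-x ^ 2) := by fun_prop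

theorem memLp_eval_hermiteMeasure (p : ℂ[X]) :
    MemLp (fun x : ℝ => p.eval (x : ℂ)) 2 hermiteMeasure := by
  have hc : Continuous fun x : ℝ => p.eval (x : ℂ) := by fun_prop
  refine (memLp_two_withDensity_ofReal_iff measurable_exp_neg_sq (fun _ => Real.exp_pos _)
    hc.aestronglyMeasurable).mpr ?_
  obtain ⟨C, hC, h⟩ := exists_norm_eval_le_mul_exp p (show (0 : ℝ) < 1 / 4 by norm_num)
  refine ((integrable_exp_neg_mul_sq (show (0 : ℝ) < 1 / 2 by norm_num)).const_mul (C ^ 2)).mono'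
    (Continuous.aestronglyMeasurable (by fun_prop)) (.of_forall fun x => ?_)
  rw [Real.norm_of_nonneg (by positivity)]
  calc _ ≤ (C * Real.exp (1 / 4 * ‖(x : ℂ)‖ ^ 2)) ^ 2 * Real.exp (-x ^ 2) := by
        gcongr
        exact h x
    _ = C ^ 2 * Real.exp (-(1 / 2) * x ^ 2) := by
        rw [mul_pow, ← Real.exp_nat_mul, mul_assoc, ← Real.exp_add, Complex.norm_real,
          Real.norm_eq_abs, sq_abs]
        push_cast
        ring_nf

theorem memLp_hermiteONC_hermiteMeasure (k : ℕ) :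
    MemLp (fun x : ℝ => hermiteONC k x) 2 hermiteMeasure := by
  simpa only [hermiteONC, div_eq_inv_mul] using!
    (memLp_eval_hermiteMeasure (hermiteC k)).const_mul _

theorem memLp_exp_abs_hermiteMeasure (t : ℝ) :
    MemLp (fun x : ℝ => (Real.exp (t * |x|) : ℂ)) 2 hermiteMeasure := by
  have hc : Continuous fun x : ℝ => (Real.exp (t * |x|) : ℂ) := by fun_prop
  refine (memLp_two_withDensity_ofReal_iff measurable_exp_neg_sq (fun _ => Real.exp_pos _)
    hc.aestronglyMeasurable).mpr ?_
  refine ((integrable_exp_neg_mul_sq (show (0 : ℝ) < 1 / 2 by norm_num)).const_mul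
    (Real.exp (2 * t ^ 2))).mono'
    (Continuous.aestronglyMeasurable (by fun_prop)) (.of_forall fun x => ?_)
  rw [Real.norm_of_nonneg (by positivity), Complex.norm_real,
    Real.norm_of_nonneg (Real.exp_pos _).le, ← Real.exp_nat_mul, ← Real.exp_add,
    ← Real.exp_add, Real.exp_le_exp]
  push_cast
  nlinarith [sq_nonneg (|x| - 2 * t), sq_abs x]

theorem integrable_mul_mul_exp {f g : ℝ → ℂ} (hf : MemLp f 2 hermiteMeasure)
    (hg : MemLp g 2 hermiteMeasure) :
    Integrable fun x => f x * g x * (Real.exp (-x ^ 2) : ℂ) :=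
  (integrable_withDensity_ofReal_iff measurable_exp_neg_sq fun _ => Real.exp_pos _).mp
    (hf.integrable_mul hg)

theorem hermiteCoeff_eq (f : ℝ → ℂ) (k : ℕ) :
    hermiteCoeff f k = ∫ x : ℝ, f x * hermiteONC k x * (Real.exp (-x ^ 2) : ℂ) := by
  simp only [hermiteCoeff, ofReal_hermiteON]

open scoped ContDiff in
/-- An integrable function on the line whose Fourier transform vanishes is zero almost
everywhere. -/
theorem ae_eq_zero_of_integral_exp_mul_I_eq_zero {g : ℝ → ℂ} (hg : Integrable g)
    (h : ∀ t : ℝ, ∫ x : ℝ, Complex.exp (t * x * Complex.I) * g x = 0) : ∀ᵐ x, g x = 0 := by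
  have hF : FourierTransform.fourier g = (0 : ℝ → ℂ) := by
    ext w
    rw [Real.fourier_real_eq_integral_exp_smul, Pi.zero_apply, ← h (-2 * Real.pi * w)]
    refine integral_congr_ae (.of_forall fun x => ?_)
    simp only [smul_eq_mul]
    congr 2
    push_cast
    ring
  refine ae_eq_zero_of_integral_contDiff_smul_eq_zero hg.locallyIntegrable fun ψ hψ hc => ?_
  have hc' : HasCompactSupport (Complex.ofRealCLM ∘ ψ) := hc.comp_left rfl
  have hψ' : ContDiff ℝ ∞ (Complex.ofRealCLM ∘ ψ) := by fun_prop
  let Ψ : SchwartzMap ℝ ℂ := hc'.toSchwartzMap hψ'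
  have hflip : ∫ w : ℝ, FourierTransform.fourier g w •
        (FourierTransformInv.fourierInv Ψ : SchwartzMap ℝ ℂ) w =
      ∫ x : ℝ, g x • FourierTransform.fourier
        ((FourierTransformInv.fourierInv Ψ : SchwartzMap ℝ ℂ) : ℝ → ℂ) x := by
    simpa using! VectorFourier.integral_fourierIntegral_smul_eq_flip (L := innerₗ ℝ)
      Real.continuous_fourierChar continuous_inner hg
      (FourierTransformInv.fourierInv Ψ : SchwartzMap ℝ ℂ).integrable
  rw [← SchwartzMap.fourier_coe, FourierTransform.fourier_fourierInv_eq, hF] at hflip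
  simp only [Pi.zero_apply, zero_smul, integral_zero] at hflip
  rw [hflip]
  refine integral_congr_ae (.of_forall fun x => ?_)
  simp [Ψ, mul_comm]

/-- A function orthogonal to all Hermite polynomials is orthogonal to all monomials, since
multiplication by `X` preserves the span of the `H_k`. -/
theorem integral_mul_pow_eq_zero {f : ℝ → ℂ} (hf : MemLp f 2 hermiteMeasure)
    (h0 : ∀ k, hermiteCoeff f k = 0) (n : ℕ) :
    ∫ x : ℝ, f x * (x : ℂ) ^ n * (Real.exp (-x ^ 2) : ℂ) = 0 := by
  have key : ∀ n k, ∫ x : ℝ, f x * (X ^ n * hermiteC k).eval (x : ℂ) *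
      (Real.exp (-x ^ 2) : ℂ) = 0 := by
    intro n
    induction n with
    | zero =>
      intro k
      have h := h0 k
      simp only [hermiteCoeff_eq, hermiteONC, mul_div_assoc', div_mul_eq_mul_div, integral_div] at h
      rw [div_eq_zero_iff, or_iff_left
        (Complex.ofReal_ne_zero.mpr (sqrt_hermite_norm_pos k).ne')] at h
      simpa using h
    | succ n ih =>
      intro k
      have e : ∀ x : ℂ, ((X : ℂ[X]) ^ (n + 1) * hermiteC k).eval x =
          1 / 2 * (X ^ n * hermiteC (k + 1)).eval x + k * (X ^ n * hermiteC (k - 1)).eval x := by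
        intro x
        simp only [hermiteC_succ, eval_mul, eval_sub, eval_pow, eval_X, eval_ofNat, eval_natCast]
        ring
      have e' : ∀ x : ℝ, f x * (X ^ (n + 1) * hermiteC k).eval (x : ℂ) *
          (Real.exp (-x ^ 2) : ℂ) =
          1 / 2 * (f x * (X ^ n * hermiteC (k + 1)).eval (x : ℂ) * (Real.exp (-x ^ 2) : ℂ)) +
            k * (f x * (X ^ n * hermiteC (k - 1)).eval (x : ℂ) * (Real.exp (-x ^ 2) : ℂ)) := by
        intro x
        rw [e]
        ring
      simp only [e']
      have hi := fun p : ℂ[X] => integrable_mul_mul_exp hf (memLp_eval_hermiteMeasure p)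
      rw [integral_add ((hi _).const_mul _) ((hi _).const_mul _), integral_const_mul,
        integral_const_mul, ih, ih]
      simp
  simpa [hermiteC_zero] using key n 0

/-- Completeness of the Hermite polynomials. If all Hermite coefficients of `f` vanish, so do all
moments of `f(x) exp(-x²)`, which are the Taylor coefficients of its Fourier transform. -/
theorem ae_eq_zero_of_hermiteCoeff_eq_zero {f : ℝ → ℂ} (hf : MemLp f 2 hermiteMeasure)
    (h0 : ∀ k, hermiteCoeff f k = 0) : ∀ᵐ x, f x = 0 := by
  have hone : MemLp (fun _ : ℝ => (1 : ℂ)) 2 hermiteMeasure := by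
    simpa using memLp_eval_hermiteMeasure 1
  have hg : Integrable fun x : ℝ => f x * (Real.exp (-x ^ 2) : ℂ) := by
    simpa using integrable_mul_mul_exp hf hone
  have h : ∀ᵐ x : ℝ, f x * (Real.exp (-x ^ 2) : ℂ) = 0 := by
    refine ae_eq_zero_of_integral_exp_mul_I_eq_zero hg fun t => ?_
    have hterm : ∀ (n : ℕ) (x : ℝ), ‖(t * x * Complex.I) ^ n / n.factorial *
        (f x * (Real.exp (-x ^ 2) : ℂ))‖ =
        (|t| * |x|) ^ n / n.factorial * ‖f x * (Real.exp (-x ^ 2) : ℂ)‖ := by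
      intro n x
      rw [norm_mul, norm_div, norm_pow, norm_mul, norm_mul, Complex.norm_I, Complex.norm_real,
        Complex.norm_real, Complex.norm_natCast, mul_one, Real.norm_eq_abs, Real.norm_eq_abs]
    have hsum : ∀ x : ℝ, HasSum (fun n : ℕ => (|t| * |x|) ^ n / n.factorial *
        ‖f x * (Real.exp (-x ^ 2) : ℂ)‖)
        (Real.exp (|t| * |x|) * ‖f x * (Real.exp (-x ^ 2) : ℂ)‖) := fun x => by
      have := NormedSpace.expSeries_div_hasSum_exp (|t| * |x|)
      rw [← Real.exp_eq_exp_ℝ] at this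
      exact this.mul_right _
    have hs := hasSum_integral_of_dominated_convergence (μ := (volume : Measure ℝ))
      (F := fun (n : ℕ) (x : ℝ) => (t * x * Complex.I) ^ n / n.factorial *
        (f x * (Real.exp (-x ^ 2) : ℂ)))
      (f := fun x : ℝ => Complex.exp (t * x * Complex.I) * (f x * (Real.exp (-x ^ 2) : ℂ)))
      (bound := fun n x => (|t| * |x|) ^ n / n.factorial * ‖f x * (Real.exp (-x ^ 2) : ℂ)‖)
      (fun n => (Continuous.aestronglyMeasurable (by fun_prop)).mul hg.aestronglyMeasurable)
      (fun n => .of_forall fun x => (hterm n x).le)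
      (.of_forall fun x => (hsum x).summable) ?_ (.of_forall fun x => ?_)
    · have hz : ∀ n : ℕ, ∫ x : ℝ, (t * x * Complex.I) ^ n / n.factorial *
        (f x * (Real.exp (-x ^ 2) : ℂ)) = 0 := by
        intro n
        have : ∀ x : ℝ, (t * x * Complex.I) ^ n / n.factorial * (f x * (Real.exp (-x ^ 2) : ℂ)) =
            (t * Complex.I) ^ n / n.factorial * (f x * (x : ℂ) ^ n * (Real.exp (-x ^ 2) : ℂ)) := by
          intro x; rw [mul_right_comm, mul_pow]; ring
        simp only [this, integral_const_mul, integral_mul_pow_eq_zero hf h0, mul_zero]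
      simp only [hz] at hs
      exact hs.unique hasSum_zero
    · simp only [(hsum _).tsum_eq]
      have := (integrable_mul_mul_exp hf (memLp_exp_abs_hermiteMeasure |t|)).norm
      refine this.congr (.of_forall fun x => ?_)
      simp only [norm_mul, Complex.norm_real, Real.norm_of_nonneg (Real.exp_pos _).le]
      ring
    · have := NormedSpace.expSeries_div_hasSum_exp (t * x * Complex.I : ℂ)
      rw [← Complex.exp_eq_exp_ℂ] at this
      exact this.mul_right _
  filter_upwards [h] with x hx
  exact (mul_eq_zero.mp hx).resolve_right (Complex.ofReal_ne_zero.mpr (Real.exp_pos _).ne')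

theorem orthonormal_hermite :
    Orthonormal ℂ fun k => (memLp_hermiteONC_hermiteMeasure k).toLp := by
  rw [orthonormal_iff_ite]
  intro i j
  rw [inner_toLp_toLp, hermiteMeasure,
    integral_withDensity_ofReal measurable_exp_neg_sq fun _ => Real.exp_pos _]
  simp only [conj_hermiteONC_ofReal, integral_hermiteONC_mul_hermiteONC, eq_comm]

theorem inner_hermite_toLp {f : ℝ → ℂ} (hf : MemLp f 2 hermiteMeasure) (k : ℕ) :
    inner ℂ ((memLp_hermiteONC_hermiteMeasure k).toLp) (hf.toLp f) = hermiteCoeff f k := by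
  rw [inner_toLp_toLp, hermiteMeasure,
    integral_withDensity_ofReal measurable_exp_neg_sq fun _ => Real.exp_pos _]
  simp only [conj_hermiteONC_ofReal, hermiteCoeff_eq]

/-- The Hermite expansion of a function in `L²(exp(-x²) dx)` converges to it in `L²`. -/
theorem hasSum_hermiteCoeff_smul {f : ℝ → ℂ} (hf : MemLp f 2 hermiteMeasure) :
    HasSum (fun k => hermiteCoeff f k • (memLp_hermiteONC_hermiteMeasure k).toLp)
      (hf.toLp f) := by
  have hbot : (Submodule.span ℂ
      (Set.range fun k => (memLp_hermiteONC_hermiteMeasure k).toLp))ᗮ = ⊥ := by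
    rw [Submodule.eq_bot_iff]
    intro g hg
    have h0 : ∀ k, hermiteCoeff g k = 0 := fun k => by
      rw [← inner_hermite_toLp (Lp.memLp g), Lp.toLp_coeFn]
      exact (Submodule.mem_orthogonal _ _).mp hg _ (Submodule.subset_span ⟨k, rfl⟩)
    rw [Lp.eq_zero_iff_ae_eq_zero]
    exact (ae_withDensity_ofReal_iff measurable_exp_neg_sq fun _ => Real.exp_pos _).mpr
      (ae_eq_zero_of_hermiteCoeff_eq_zero (Lp.memLp g) h0)
  have h := (HilbertBasis.mkOfOrthogonalEqBot orthonormal_hermite hbot).hasSum_repr (hf.toLp f)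
  simpa only [HilbertBasis.repr_apply_apply, HilbertBasis.coe_mkOfOrthogonalEqBot,
    inner_hermite_toLp] using h

/-! ### The weighted Bergman space -/

/-- The constant in front of the area integrals. -/
def areaConst (θ : ℝ) : ℝ := 2 / √(Real.pi * (θ ^ 2 - 1))

theorem areaConst_pos {θ : ℝ} (hθ : 1 < θ) : 0 < areaConst θ :=
  div_pos two_pos (Real.sqrt_pos.mpr (mul_pos Real.pi_pos (by nlinarith)))

theorem areaConst_mul_sqrt {θ : ℝ} (hθ : 1 < θ) :
    areaConst θ * √(Real.pi * (θ ^ 2 - 1) / 4) = 1 := by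
  have h : 0 < √(Real.pi * (θ ^ 2 - 1)) :=
    Real.sqrt_pos.mpr (mul_pos Real.pi_pos (by nlinarith))
  have h4 : √(4 : ℝ) = 2 := by
    rw [show (4 : ℝ) = 2 ^ 2 by norm_num, Real.sqrt_sq two_pos.le]
  rw [areaConst, Real.sqrt_div' _ (by norm_num), h4]
  field_simp

theorem areaWeight_pos (θ : ℝ) (z : ℂ) : 0 < areaWeight θ z := Real.exp_pos _

/-- The measure `areaConst θ * areaWeight θ z dσ` on the plane, whose square integrable entire
functions form the weighted Bergman space. -/
def bergmanMeasure (θ : ℝ) : Measure ℂ :=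
  volume.withDensity fun z => ENNReal.ofReal (areaConst θ * areaWeight θ z)

theorem measurable_bergmanDensity (θ : ℝ) : Measurable fun z => areaConst θ * areaWeight θ z :=
  ((continuous_areaWeight θ).const_mul _).measurable

theorem bergmanDensity_pos {θ : ℝ} (hθ : 1 < θ) (z : ℂ) : 0 < areaConst θ * areaWeight θ z :=
  mul_pos (areaConst_pos hθ) (areaWeight_pos θ z)

theorem memLp_bergmanMeasure_iff {θ : ℝ} (hθ : 1 < θ) {F : ℂ → ℂ} (hF : Continuous F) :
    MemLp F 2 (bergmanMeasure θ) ↔ Integrable fun z : ℂ => ‖F z‖ ^ 2 * areaWeight θ z := by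
  rw [bergmanMeasure, memLp_two_withDensity_ofReal_iff (measurable_bergmanDensity θ)
    (bergmanDensity_pos hθ) hF.aestronglyMeasurable]
  simp only [mul_left_comm _ (areaConst θ)]
  exact integrable_const_mul_iff (areaConst_pos hθ).ne'.isUnit _

theorem inner_bergman_toLp {θ : ℝ} (hθ : 1 < θ) {F G : ℂ → ℂ} (hF : MemLp F 2 (bergmanMeasure θ))
    (hG : MemLp G 2 (bergmanMeasure θ)) :
    inner ℂ (hG.toLp G) (hF.toLp F) =
      (areaConst θ : ℂ) * ∫ z : ℂ, F z * (starRingEnd ℂ) (G z) * (areaWeight θ z : ℂ) := by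
  rw [inner_toLp_toLp, bergmanMeasure,
    integral_withDensity_ofReal (measurable_bergmanDensity θ) (bergmanDensity_pos hθ),
    ← integral_const_mul]
  refine integral_congr_ae (.of_forall fun z => ?_)
  push_cast
  ring

theorem integrable_mul_conj_mul_areaWeight {θ : ℝ} (hθ : 1 < θ) {F G : ℂ → ℂ}
    (hF : MemLp F 2 (bergmanMeasure θ)) (hG : MemLp G 2 (bergmanMeasure θ)) :
    Integrable fun z : ℂ => F z * (starRingEnd ℂ) (G z) * (areaWeight θ z : ℂ) := by
  have h := (integrable_withDensity_ofReal_iff (measurable_bergmanDensity θ)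
    (bergmanDensity_pos hθ)).mp (hF.integrable_mul hG.star)
  refine (h.const_mul (areaConst θ : ℂ)⁻¹).congr (.of_forall fun z => ?_)
  have : (areaConst θ : ℂ) ≠ 0 := Complex.ofReal_ne_zero.mpr (areaConst_pos hθ).ne'
  simp only [Pi.mul_apply, Pi.star_apply, RCLike.star_def]
  push_cast
  field_simp

theorem hermiteCoeff_congr_ae {f g : ℝ → ℂ} (h : ∀ᵐ x, f x = g x) (k : ℕ) :
    hermiteCoeff f k = hermiteCoeff g k :=
  integral_congr_ae (h.mono fun x hx => by simp only [hx])

/-- The restriction to the real line of a function in the weighted Bergman space is square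
integrable for the weight `exp(-x²)`: its square is `O(exp (c x²))` for every `c > 2 / (θ + 1)`, and
`2 / (θ + 1) < 1`. -/
theorem memLp_restrict_of_integrable {θ : ℝ} (hθ : 1 < θ) {F : ℂ → ℂ} (hF : Differentiable ℂ F)
    (hi : Integrable fun z : ℂ => ‖F z‖ ^ 2 * areaWeight θ z) :
    MemLp (fun x : ℝ => F x) 2 hermiteMeasure := by
  have hFc := hF.continuous
  have hc : Continuous fun x : ℝ => F x := by fun_prop
  refine (memLp_two_withDensity_ofReal_iff measurable_exp_neg_sq (fun _ => Real.exp_pos _)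
    hc.aestronglyMeasurable).mpr ?_
  -- `2 * (1 + δ) / (θ + 1) < 1` for `δ = (θ - 1) / 4`
  have h := sq_norm_le_of_integrable hθ (show 0 < (θ - 1) / 4 by linarith) hF hi
  set A := Real.exp (2 * (1 + 1 / ((θ - 1) / 4)) * (1 / (θ + 1) + 1 / (θ - 1))) *
      ∫ z : ℂ, ‖F z‖ ^ 2 * areaWeight θ z
  have hpos : 0 < (θ - 1) / (2 * (θ + 1)) := div_pos (by linarith) (by linarith)
  refine ((integrable_exp_neg_mul_sq hpos).const_mul A).mono'
    (Continuous.aestronglyMeasurable (by fun_prop)) (.of_forall fun x => ?_)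
  rw [Real.norm_of_nonneg (by positivity)]
  refine (mul_le_mul_of_nonneg_right (h x) (Real.exp_pos _).le).trans_eq ?_
  rw [mul_assoc, ← Real.exp_add, weightForm]
  have : θ + 1 ≠ 0 := by linarith
  simp only [Complex.ofReal_re, Complex.ofReal_im]
  congr 2
  field_simp
  ring

/-- The functions `H_k / ‖H_k‖` of the weighted Bergman space. -/
def bergmanBasis (θ : ℝ) (k : ℕ) (z : ℂ) : ℂ := hermiteONC k z / (√θ ^ k : ℝ)

theorem integral_mul_conj_hermiteONC {θ : ℝ} (hθ : 1 < θ) {F : ℂ → ℂ} (hF : Differentiable ℂ F)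
    (hgr : HasModerateGrowth θ F) (k : ℕ) :
    (areaConst θ : ℂ) * ∫ z : ℂ, F z * (starRingEnd ℂ) (hermiteONC k z) * (areaWeight θ z : ℂ) =
      θ ^ k * hermiteCoeff (fun x : ℝ => F x) k := by
  have h := (integral_mul_conj_hermiteC hθ hF hgr k).2
  have hc : (areaConst θ : ℂ) * √(Real.pi * (θ ^ 2 - 1) / 4) = 1 := by
    rw [← Complex.ofReal_mul, areaConst_mul_sqrt hθ, Complex.ofReal_one]
  rw [hermiteCoeff_eq]
  simp only [hermiteONC, map_div₀, Complex.conj_ofReal, mul_div_assoc', div_mul_eq_mul_div,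
    integral_div, h]
  rw [← mul_assoc, ← mul_assoc, hc, one_mul]

theorem memLp_eval_bergmanMeasure {θ : ℝ} (hθ : 1 < θ) (p : ℂ[X]) :
    MemLp (fun z => p.eval z) 2 (bergmanMeasure θ) := by
  have hc : Continuous fun z : ℂ => p.eval z := p.continuous
  rw [memLp_bergmanMeasure_iff hθ hc]
  obtain ⟨C, hC, h⟩ := exists_norm_eval_le_mul_exp_weightForm hθ p
    (show (0 : ℝ) < 1 / 2 by norm_num)
  refine ((integrable_exp_neg_weightForm hθ one_pos).const_mul (C ^ 2)).mono'
    (Continuous.aestronglyMeasurable (by fun_prop)) (.of_forall fun z => ?_)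
  rw [Real.norm_of_nonneg (mul_nonneg (sq_nonneg _) (areaWeight_pos θ z).le), areaWeight_eq]
  calc _ ≤ (C * Real.exp (1 / 2 * weightForm θ z)) ^ 2 * Real.exp (-2 * weightForm θ z) := by
        gcongr
        exact h z
    _ = C ^ 2 * Real.exp (-1 * weightForm θ z) := by
        rw [mul_pow, ← Real.exp_nat_mul, mul_assoc, ← Real.exp_add]
        push_cast
        ring_nf

theorem hermiteONC_eq_eval (k : ℕ) : hermiteONC k = fun z =>
    (C (√(2 ^ k * (k.factorial : ℝ) * √Real.pi) : ℂ)⁻¹ * hermiteC k).eval z := by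
  ext z
  simp [hermiteONC, div_eq_inv_mul]

theorem bergmanBasis_eq_eval (θ : ℝ) (k : ℕ) : bergmanBasis θ k = fun z =>
    (C ((√θ ^ k : ℝ) : ℂ)⁻¹ * (C (√(2 ^ k * (k.factorial : ℝ) * √Real.pi) : ℂ)⁻¹ *
      hermiteC k)).eval z := by
  ext z
  rw [bergmanBasis, hermiteONC_eq_eval, eval_mul, eval_C, div_eq_inv_mul]

theorem memLp_bergmanBasis {θ : ℝ} (hθ : 1 < θ) (k : ℕ) :
    MemLp (bergmanBasis θ k) 2 (bergmanMeasure θ) := by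
  rw [bergmanBasis_eq_eval]
  exact memLp_eval_bergmanMeasure hθ _

theorem inner_bergmanBasis_toLp {θ : ℝ} (hθ : 1 < θ) {F : ℂ → ℂ} (hF : Differentiable ℂ F)
    (hgr : HasModerateGrowth θ F) (hL : MemLp F 2 (bergmanMeasure θ)) (k : ℕ) :
    inner ℂ ((memLp_bergmanBasis hθ k).toLp (bergmanBasis θ k)) (hL.toLp F) =
      (√θ ^ k : ℝ) * hermiteCoeff (fun x : ℝ => F x) k := by
  have h := integral_mul_conj_hermiteONC hθ hF hgr k
  have hpos : (√θ ^ k : ℝ) ≠ 0 := pow_ne_zero _ (Real.sqrt_pos.mpr (by linarith)).ne'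
  have hsq : (θ : ℂ) ^ k = ((√θ ^ k : ℝ) : ℂ) * ((√θ ^ k : ℝ) : ℂ) := by
    rw [← Complex.ofReal_mul, ← mul_pow, Real.mul_self_sqrt (by linarith), Complex.ofReal_pow]
  rw [inner_bergman_toLp hθ]
  simp only [bergmanBasis, map_div₀, Complex.conj_ofReal, mul_div_assoc', div_mul_eq_mul_div,
    integral_div, h, hsq]
  rw [mul_assoc, mul_div_cancel_left₀ _ (Complex.ofReal_ne_zero.mpr hpos)]

theorem hermiteCoeff_hermiteONC (k m : ℕ) :
    hermiteCoeff (fun x : ℝ => hermiteONC m x) k = if k = m then 1 else 0 := by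
  rw [hermiteCoeff_eq, integral_hermiteONC_mul_hermiteONC]
  simp only [eq_comm]

theorem hasModerateGrowth_hermiteONC {θ : ℝ} (hθ : 1 < θ) (k : ℕ) :
    HasModerateGrowth θ (hermiteONC k) := by
  rw [hermiteONC_eq_eval]
  exact hasModerateGrowth_eval hθ _

theorem orthonormal_bergmanBasis {θ : ℝ} (hθ : 1 < θ) :
    Orthonormal ℂ fun k => (memLp_bergmanBasis hθ k).toLp (bergmanBasis θ k) := by
  rw [orthonormal_iff_ite]
  intro i j
  have hgr : HasModerateGrowth θ (bergmanBasis θ j) := by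
    rw [bergmanBasis_eq_eval]
    exact hasModerateGrowth_eval hθ _
  have hd : Differentiable ℂ (bergmanBasis θ j) := (differentiable_hermiteONC j).div_const _
  have hpos : ((√θ ^ j : ℝ) : ℂ) ≠ 0 :=
    Complex.ofReal_ne_zero.mpr (pow_ne_zero _ (Real.sqrt_pos.mpr (by linarith)).ne')
  rw [inner_bergmanBasis_toLp hθ hd hgr]
  have h := hermiteCoeff_hermiteONC i j
  rw [hermiteCoeff_eq] at h ⊢
  simp only [bergmanBasis, div_mul_eq_mul_div, integral_div, h]
  split_ifs with hij
  · rw [hij, mul_one_div_cancel hpos]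
  · simp

theorem summable_smul_of_orthonormal {E : Type*} [NormedAddCommGroup E] [InnerProductSpace ℂ E]
    [CompleteSpace E] {v : ℕ → E} (hv : Orthonormal ℂ v) {a : ℕ → ℂ}
    (ha : Summable fun k => ‖a k‖ ^ 2) : Summable fun k => a k • v k :=
  (hv.orthogonalFamily.summable_iff_norm_sq_summable a).mpr ha

theorem hasSum_mul_conj_of_orthonormal {E : Type*} [NormedAddCommGroup E] [InnerProductSpace ℂ E]
    {v : ℕ → E} (hv : Orthonormal ℂ v) {a b : ℕ → ℂ} {x y : E}
    (hx : HasSum (fun k => a k • v k) x) (hy : HasSum (fun k => b k • v k) y) :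
    HasSum (fun k => a k * (starRingEnd ℂ) (b k)) (inner ℂ y x) := by
  have hb : ∀ k, inner ℂ (v k) y = b k := by
    intro k
    have h := hy.mapL (innerSL ℂ (v k))
    simp only [innerSL_apply_apply, inner_smul_right, orthonormal_iff_ite.mp hv] at h
    refine h.unique ?_
    have hk := hasSum_single (f := fun j => b j * if k = j then (1 : ℂ) else 0) k
      fun j hj => by simp [hj.symm]
    rwa [if_pos rfl, mul_one] at hk
  have h := hx.mapL (innerSL ℂ y)
  simp only [innerSL_apply_apply, inner_smul_right] at h
  refine h.congr_fun fun k => ?_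
  rw [← hb, inner_conj_symm]

/-! ### The entire function with given Hermite coefficients -/

/-- Point evaluation of `h_k`, estimated in the Bergman space of a parameter `η`. -/
theorem exists_sq_norm_hermiteONC_le {η : ℝ} (hη : 1 < η) (R : ℝ) :
    ∃ M : ℝ, 0 ≤ M ∧ ∀ k, ∀ z ∈ Metric.ball (0 : ℂ) R, ‖hermiteONC k z‖ ^ 2 ≤ M * η ^ k := by
  obtain ⟨B, hB⟩ := (isCompact_closedBall (0 : ℂ) R).exists_bound_of_continuousOn
    (continuous_weightForm η).continuousOn
  have hnorm : ∀ k, ∫ z : ℂ, ‖hermiteONC k z‖ ^ 2 * areaWeight η z = (areaConst η)⁻¹ * η ^ k := by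
    intro k
    have h := integral_mul_conj_hermiteONC hη (differentiable_hermiteONC k)
      (hasModerateGrowth_hermiteONC hη k) k
    rw [hermiteCoeff_hermiteONC, if_pos rfl, mul_one] at h
    simp only [RCLike.mul_conj, RCLike.ofReal_eq_complex_ofReal, ← Complex.ofReal_pow,
      ← Complex.ofReal_mul, integral_complex_ofReal, Complex.ofReal_inj] at h
    rw [← h, inv_mul_cancel_left₀ (areaConst_pos hη).ne']
  have hinv := inv_pos.mpr (areaConst_pos hη)
  refine ⟨Real.exp (2 * (1 + 1 / (1 / 2)) * (1 / (η + 1) + 1 / (η - 1))) * (areaConst η)⁻¹ *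
    Real.exp (3 * B), by positivity, fun k z hz => ?_⟩
  have hd := differentiable_hermiteONC k
  have hL : MemLp (hermiteONC k) 2 (bergmanMeasure η) := by
    rw [hermiteONC_eq_eval]
    exact memLp_eval_bergmanMeasure hη _
  have h := sq_norm_le_of_integrable hη one_half_pos hd
    ((memLp_bergmanMeasure_iff hη hd.continuous).mp hL) z
  rw [hnorm] at h
  refine h.trans ?_
  have hz' : weightForm η z ≤ B :=
    (le_abs_self _).trans (hB z (Metric.ball_subset_closedBall hz))
  have hexp : Real.exp (2 * (1 + 1 / 2) * weightForm η z) ≤ Real.exp (3 * B) :=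
    Real.exp_le_exp.mpr (by linarith)
  have hη0 : 0 < η := by linarith
  refine (mul_le_mul_of_nonneg_left hexp (by positivity)).trans_eq ?_
  ring

theorem summable_norm_mul_sqrt_pow {θ η : ℝ} (hη : 1 < η) (hηθ : η < θ) {a : ℕ → ℂ}
    (ha : Summable fun k => ‖a k‖ ^ 2 * θ ^ k) : Summable fun k => ‖a k‖ * √η ^ k := by
  have hη0 : 0 < η := by linarith
  have hθ0 : 0 < θ := by linarith
  have hgeo : Summable fun k : ℕ => (η / θ) ^ k :=
    summable_geometric_of_lt_one (by positivity) ((div_lt_one hθ0).mpr hηθ)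
  refine (ha.add hgeo).of_nonneg_of_le (fun k => by positivity) fun k => ?_
  have hs : 0 < √θ ^ k := pow_pos (Real.sqrt_pos.mpr hθ0) k
  have hs2 : (√θ ^ k) ^ 2 = θ ^ k := by rw [← pow_mul, mul_comm, pow_mul, Real.sq_sqrt hθ0.le]
  have ht2 : (√η ^ k) ^ 2 = η ^ k := by rw [← pow_mul, mul_comm, pow_mul, Real.sq_sqrt hη0.le]
  have h1 : ‖a k‖ * √η ^ k = (‖a k‖ * √θ ^ k) * (√η ^ k / √θ ^ k) := by field_simp
  have h2 : ∀ p q : ℝ, p * q ≤ p ^ 2 + q ^ 2 := fun p q => by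
    nlinarith [sq_nonneg (p - q), sq_nonneg p, sq_nonneg q]
  refine h1.trans_le ((h2 _ _).trans_eq ?_)
  rw [mul_pow, div_pow, hs2, ht2, div_pow]

/-- If `∑ |a_k|² θ^k < ∞`, then `∑ a_k h_k` converges locally uniformly on the plane, by point
evaluation estimates in the Bergman space of a parameter strictly between `1` and `θ`. -/
theorem exists_entire_hasSum {θ : ℝ} (hθ : 1 < θ) {a : ℕ → ℂ}
    (ha : Summable fun k => ‖a k‖ ^ 2 * θ ^ k) :
    ∃ F : ℂ → ℂ, Differentiable ℂ F ∧ ∀ z, HasSum (fun k => a k * hermiteONC k z) (F z) := by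
  obtain ⟨η, hη, hηθ⟩ := exists_between hθ
  have key : ∀ R : ℝ, ∃ u : ℕ → ℝ, Summable u ∧
      ∀ k, ∀ z ∈ Metric.ball (0 : ℂ) R, ‖a k * hermiteONC k z‖ ≤ u k := by
    intro R
    obtain ⟨M, hM, h⟩ := exists_sq_norm_hermiteONC_le hη R
    refine ⟨fun k => ‖a k‖ * √η ^ k * √M, (summable_norm_mul_sqrt_pow hη hηθ ha).mul_right _,
      fun k z hz => ?_⟩
    simp only [norm_mul, mul_assoc]
    refine mul_le_mul_of_nonneg_left (abs_le_of_sq_le_sq' ?_ (by positivity)).2 (norm_nonneg _)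
    rw [mul_pow, Real.sq_sqrt hM, ← pow_mul, mul_comm k 2, pow_mul, Real.sq_sqrt (by linarith),
      mul_comm]
    exact h k z hz
  refine ⟨fun z => ∑' k, a k * hermiteONC k z, fun z => ?_, fun z => ?_⟩
  · obtain ⟨u, hu, hb⟩ := key (‖z‖ + 1)
    have hd := Complex.differentiableOn_tsum_of_summable_norm hu
      (fun k => ((differentiable_hermiteONC k).const_mul (a k)).differentiableOn)
      Metric.isOpen_ball hb
    exact hd.differentiableAt (Metric.isOpen_ball.mem_nhds (by simp))
  · obtain ⟨u, hu, hb⟩ := key (‖z‖ + 1)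
    exact (hu.of_norm_bounded fun k => hb k z (by simp)).hasSum

theorem IsEntireExtension.unique {f : ℝ → ℂ} {F G : ℂ → ℂ} (hF : IsEntireExtension f F)
    (hG : IsEntireExtension f G) : F = G := by
  have hFc := hF.1.continuous
  have hGc := hG.1.continuous
  have hae : (fun x : ℝ => F x) =ᵐ[volume] fun x : ℝ => G x := by
    filter_upwards [hF.2, hG.2] with x h1 h2
    rw [← h1, ← h2]
  have heq : (fun x : ℝ => F x) = fun x : ℝ => G x :=
    (Continuous.ae_eq_iff_eq volume (by fun_prop) (by fun_prop)).mp hae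
  have hlim : Filter.Tendsto (fun x : ℝ => (x : ℂ)) (nhdsWithin 0 {0}ᶜ) (nhdsWithin 0 {0}ᶜ) := by
    refine tendsto_nhdsWithin_iff.mpr ⟨?_, ?_⟩
    · exact (Complex.continuous_ofReal.tendsto' 0 0 rfl).mono_left nhdsWithin_le_nhds
    · filter_upwards [self_mem_nhdsWithin] with x hx
      simpa using hx
  refine AnalyticOnNhd.eq_of_frequently_eq (z₀ := 0)
    (hF.1.differentiableOn.analyticOnNhd isOpen_univ)
    (hG.1.differentiableOn.analyticOnNhd isOpen_univ) ?_
  exact hlim.frequently (Filter.Eventually.frequently (.of_forall fun x => congrFun heq x))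

/-- A function in the Hermite space has an entire extension, the sum of its Hermite series, and that
series converges to it in the weighted Bergman space. -/
theorem MemHermiteSpace.exists_extension_hasSum {θ : ℝ} (hθ : 1 < θ) {f : ℝ → ℂ}
    (hf : MemHermiteSpace θ f) : ∃ F, IsEntireExtension f F ∧
      ∃ hL : MemLp F 2 (bergmanMeasure θ),
        HasSum (fun k => (hermiteCoeff f k * (√θ ^ k : ℝ)) •
          (memLp_bergmanBasis hθ k).toLp (bergmanBasis θ k)) (hL.toLp F) := by
  have hθ0 : 0 < θ := by linarith
  obtain ⟨F, hF, hsum⟩ := exists_entire_hasSum hθ hf.2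
  refine ⟨F, ⟨hF, ?_⟩, ?_⟩
  · have h := ae_eq_of_hasSum_toLp memLp_hermiteONC_hermiteMeasure (hasSum_hermiteCoeff_smul hf.1)
      (S := fun x : ℝ => F x) fun x => hsum x
    exact (ae_withDensity_ofReal_iff measurable_exp_neg_sq fun _ => Real.exp_pos _).mp
      (hf.1.coeFn_toLp.symm.trans h)
  · have hs : Summable fun k => ‖hermiteCoeff f k * (√θ ^ k : ℝ)‖ ^ 2 := by
      refine hf.2.congr fun k => ?_
      rw [norm_mul, mul_pow, Complex.norm_real, Real.norm_of_nonneg (by positivity), ← pow_mul,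
        mul_comm k 2, pow_mul, Real.sq_sqrt hθ0.le]
    obtain ⟨g, hg⟩ := summable_smul_of_orthonormal (orthonormal_bergmanBasis hθ) hs
    have hgF := ae_eq_of_hasSum_toLp (memLp_bergmanBasis hθ) hg (S := F) fun z => by
      refine (hsum z).congr_fun fun k => ?_
      have : ((√θ ^ k : ℝ) : ℂ) ≠ 0 :=
        Complex.ofReal_ne_zero.mpr (pow_pos (Real.sqrt_pos.mpr hθ0) k).ne'
      rw [bergmanBasis, mul_assoc, mul_div_cancel₀ _ this]
    have hL : MemLp F 2 (bergmanMeasure θ) := (Lp.memLp g).ae_eq hgF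
    refine ⟨hL, ?_⟩
    have : hL.toLp F = g := by
      rw [← Lp.toLp_coeFn g (Lp.memLp g)]
      exact (MemLp.toLp_eq_toLp_iff _ _).mpr hgF.symm
    rwa [this]

theorem MemHermiteSpace.hasSum_bergmanBasis {θ : ℝ} (hθ : 1 < θ) {f : ℝ → ℂ} {F : ℂ → ℂ}
    (hf : MemHermiteSpace θ f) (hF : IsEntireExtension f F) :
      ∃ hL : MemLp F 2 (bergmanMeasure θ),
        HasSum (fun k => (hermiteCoeff f k * (√θ ^ k : ℝ)) •
          (memLp_bergmanBasis hθ k).toLp (bergmanBasis θ k)) (hL.toLp F) := by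
  obtain ⟨G, hG, h⟩ := hf.exists_extension_hasSum hθ
  rwa [hF.unique hG]

/-- The converse inclusion is Bessel's inequality in the weighted Bergman space. -/
theorem memHermiteSpace_of_integrable {θ : ℝ} (hθ : 1 < θ) {f : ℝ → ℂ} {F : ℂ → ℂ}
    (hF : IsEntireExtension f F) (hi : Integrable fun z : ℂ => ‖F z‖ ^ 2 * areaWeight θ z) :
    MemHermiteSpace θ f := by
  have hθ0 : 0 < θ := by linarith
  have hL := (memLp_bergmanMeasure_iff hθ hF.1.continuous).mpr hi
  refine ⟨(memLp_restrict_of_integrable hθ hF.1 hi).ae_eq ?_, ?_⟩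
  · exact (ae_withDensity_ofReal_iff measurable_exp_neg_sq fun _ => Real.exp_pos _).mpr
      (hF.2.mono fun x hx => hx.symm)
  · refine ((orthonormal_bergmanBasis hθ).inner_products_summable (hL.toLp F)).congr fun k => ?_
    rw [inner_bergmanBasis_toLp hθ hF.1 (hasModerateGrowth_of_integrable hθ hF.1 hi) hL,
      ← hermiteCoeff_congr_ae hF.2, norm_mul, mul_pow, Complex.norm_real,
      Real.norm_of_nonneg (by positivity), ← pow_mul, mul_comm k 2, pow_mul, Real.sq_sqrt hθ0.le,
      mul_comm]

/-- Parseval's identity in the weighted Bergman space. -/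
theorem hasSum_hermiteCoeff_mul_conj {θ : ℝ} (hθ : 1 < θ) {f g : ℝ → ℂ} {F G : ℂ → ℂ}
    (hf : MemHermiteSpace θ f) (hF : IsEntireExtension f F)
    (hg : MemHermiteSpace θ g) (hG : IsEntireExtension g G) :
    HasSum (fun k => hermiteCoeff f k * (starRingEnd ℂ) (hermiteCoeff g k) * (θ : ℂ) ^ k)
      ((areaConst θ : ℂ) * ∫ z : ℂ, F z * (starRingEnd ℂ) (G z) * (areaWeight θ z : ℂ)) := by
  obtain ⟨hFL, hFs⟩ := hf.hasSum_bergmanBasis hθ hF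
  obtain ⟨hGL, hGs⟩ := hg.hasSum_bergmanBasis hθ hG
  rw [← inner_bergman_toLp hθ hFL hGL]
  refine (hasSum_mul_conj_of_orthonormal (orthonormal_bergmanBasis hθ) hFs hGs).congr_fun
    fun k => ?_
  have hsq : (θ : ℂ) ^ k = ((√θ ^ k : ℝ) : ℂ) * ((√θ ^ k : ℝ) : ℂ) := by
    rw [← Complex.ofReal_mul, ← mul_pow, Real.mul_self_sqrt (by linarith), Complex.ofReal_pow]
  rw [map_mul, Complex.conj_ofReal, hsq]
  ring

theorem integral_hermiteC_mul_conj_areaWeight {θ : ℝ} (hθ : 1 < θ) (k m : ℕ) :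
    ((2 / √(θ ^ 2 - 1) : ℝ) : ℂ) * ∫ z : ℂ, (hermiteC k).eval z *
        (starRingEnd ℂ) ((hermiteC m).eval z) * (areaWeight θ z : ℂ) =
      if k = m then ((Real.pi * (2 * θ) ^ k * (k.factorial : ℝ) : ℝ) : ℂ) else 0 := by
  rw [(integral_mul_conj_hermiteC hθ (hermiteC k).differentiable
    (hasModerateGrowth_eval hθ (hermiteC k)) m).2, integral_hermiteC_mul_hermiteC]
  split_ifs with hkm
  · subst hkm
    have hpos : 0 < √(θ ^ 2 - 1) := Real.sqrt_pos.mpr (by nlinarith)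
    have h4 : √(4 : ℝ) = 2 := by
      rw [show (4 : ℝ) = 2 ^ 2 by norm_num, Real.sqrt_sq two_pos.le]
    have hsq : √Real.pi * √Real.pi = Real.pi := Real.mul_self_sqrt Real.pi_pos.le
    have h : 2 / √(θ ^ 2 - 1) * (√(Real.pi * (θ ^ 2 - 1) / 4) * θ ^ k *
        (2 ^ k * k.factorial * √Real.pi)) = Real.pi * (2 * θ) ^ k * (k.factorial : ℝ) := by
      rw [Real.sqrt_div' _ (by norm_num), h4, Real.sqrt_mul Real.pi_pos.le, mul_pow]
      field_simp
      rw [sq, hsq]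
    rw [← h]
    push_cast
    ring
  · simp

end HermiteExpansion

end

theorem mainTheorem3 (θ : ℝ) (hθ : 1 < θ) :
    -- characterization of square summability with weight `θ ^ k`
    (∀ f : ℝ → ℂ,
      HermiteExpansion.MemHermiteSpace θ f ↔
        ∃ F : ℂ → ℂ, HermiteExpansion.IsEntireExtension f F ∧
          Integrable (fun z : ℂ => ‖F z‖ ^ 2 * HermiteExpansion.areaWeight θ z)) ∧
    -- the norm
    (∀ (f : ℝ → ℂ) (F : ℂ → ℂ),
      HermiteExpansion.MemHermiteSpace θ f → HermiteExpansion.IsEntireExtension f F →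
        Integrable (fun z : ℂ => ‖F z‖ ^ 2 * HermiteExpansion.areaWeight θ z) ∧
        HasSum (fun k : ℕ => ‖HermiteExpansion.hermiteCoeff f k‖ ^ 2 * θ ^ k)
          (2 / √(Real.pi * (θ ^ 2 - 1)) *
            ∫ z : ℂ, ‖F z‖ ^ 2 * HermiteExpansion.areaWeight θ z)) ∧
    -- the inner product
    (∀ (f g : ℝ → ℂ) (F G : ℂ → ℂ),
      HermiteExpansion.MemHermiteSpace θ f → HermiteExpansion.IsEntireExtension f F →
      HermiteExpansion.MemHermiteSpace θ g → HermiteExpansion.IsEntireExtension g G →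
        Integrable (fun z : ℂ =>
          F z * (starRingEnd ℂ) (G z) * (HermiteExpansion.areaWeight θ z : ℂ)) ∧
        HasSum (fun k : ℕ => HermiteExpansion.hermiteCoeff f k *
            (starRingEnd ℂ) (HermiteExpansion.hermiteCoeff g k) * (θ : ℂ) ^ k)
          (((2 / √(Real.pi * (θ ^ 2 - 1)) : ℝ) : ℂ) *
            ∫ z : ℂ, F z * (starRingEnd ℂ) (G z) *
              (HermiteExpansion.areaWeight θ z : ℂ))) ∧
    -- orthogonality of the Hermite polynomials over the complex plane
    (∀ k m : ℕ,
      Integrable (fun z : ℂ => aeval z (HermiteExpansion.hermiteH k) *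
        (starRingEnd ℂ) (aeval z (HermiteExpansion.hermiteH m)) *
          (HermiteExpansion.areaWeight θ z : ℂ)) ∧
      ((2 / √(θ ^ 2 - 1) : ℝ) : ℂ) *
          (∫ z : ℂ, aeval z (HermiteExpansion.hermiteH k) *
            (starRingEnd ℂ) (aeval z (HermiteExpansion.hermiteH m)) *
              (HermiteExpansion.areaWeight θ z : ℂ)) =
        if k = m then ((Real.pi * (2 * θ) ^ k * (k.factorial : ℝ) : ℝ) : ℂ) else 0) := by
  open HermiteExpansion in
  refine ⟨fun f => ⟨fun hf => ?_, fun ⟨F, hF, hi⟩ => memHermiteSpace_of_integrable hθ hF hi⟩,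
    fun f F hf hF => ?_, fun f g F G hf hF hg hG => ?_, fun k m => ⟨?_, ?_⟩⟩
  · obtain ⟨F, hF, hL, -⟩ := hf.exists_extension_hasSum hθ
    exact ⟨F, hF, (memLp_bergmanMeasure_iff hθ hF.1.continuous).mp hL⟩
  · obtain ⟨hL, -⟩ := hf.hasSum_bergmanBasis hθ hF
    refine ⟨(memLp_bergmanMeasure_iff hθ hF.1.continuous).mp hL, ?_⟩
    have h := hasSum_hermiteCoeff_mul_conj hθ hf hF hf hF
    simp only [RCLike.mul_conj, RCLike.ofReal_eq_complex_ofReal, ← Complex.ofReal_pow,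
      ← Complex.ofReal_mul, integral_complex_ofReal] at h
    exact Complex.hasSum_ofReal.mp h
  · obtain ⟨hFL, -⟩ := hf.hasSum_bergmanBasis hθ hF
    obtain ⟨hGL, -⟩ := hg.hasSum_bergmanBasis hθ hG
    exact ⟨integrable_mul_conj_mul_areaWeight hθ hFL hGL,
      hasSum_hermiteCoeff_mul_conj hθ hf hF hg hG⟩
  · simp only [aeval_hermiteH]
    exact (integral_mul_conj_hermiteC hθ (hermiteC k).differentiable
      (hasModerateGrowth_eval hθ (hermiteC k)) m).1
  · simp only [aeval_hermiteH]
    exact integral_hermiteC_mul_conj_areaWeight hθ k m
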